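/- **Notation.** Let $n\ge 2$. The Gegenbauer polynomials are given by $P_0^{(n)}=1$, $P_1^{(n)}=t$ and $(i+n-2)P_{i+1}^{(n)}=(2i+n-2)\,t\,P_i^{(n)}-i\,P_{i-1}^{(n)}$ for $i\ge1$. For a real polynomial $f$, $f_0$ denotes the coefficient of $P_0^{(n)}$ in its expansion $f=\sum_i f_iP_i^{(n)}$. For $k\ge 1$ put $$D(n,2k-1)=2\binom{n+k-2}{n-1},\qquad D(n,2k)=\binom{n+k-1}{n-1}+\binom{n+k-2}{n-1}.$$ **Theorem.** Let $n\ge2$ and $\tau\ge 1$ be integers and let $N$ be an integer with $D(n,\tau)<N\le D(n,\tau+1)$. (a) Suppose $\tau=2k-1$. There are uniquely determined real numbers $-1<\alpha_0<\dots<\alpha_{k-1}<1$ and $\rho_0,\dots,\rho_{k-1}>0$ such that $$f_0=\frac{f(1)}N+\sum_{i=0}^{k-1}\rho_i f(\alpha_i)\quad\text{for every real polynomial } f \text{ of degree at most } 2k-1$$ (the Levenshtein quadrature). Let $I\subseteq[-1,1)$ contain all $\alpha_i$, and let $h$ be absolutely monotone on $[-1,1]$, i.e. $h$ is real-valued and infinitely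 differentiable on $[-1,1]$ with $h^{(j)}\ge0$ there for all $j\ge0$. Then there is exactly one polynomial $F$ of degree at most $2k-1$ with $F(\alpha_i)=h(\alpha_i)$ and $F'(\alpha_i)=h'(\alpha_i)$ for $i=0,\dots,k-1$. It satisfies $$F(t)\le h(t)\quad\text{for all } t\in I,$$ and for every real polynomial $f$ of degree at most $\tau$ such that $f(t)\le h(t)$ for all $t\in I$ (condition (A1)), $$N(f_0N-f(1))\le N(F_0N-F(1))=N^2\sum_{i=0}^{k-1}\rho_i h(\alpha_i).$$ (b) Suppose $\tau=2k$. There are uniquely determined real numbers $-1=\beta_0<\beta_1<\dots<\beta_k<1$ and $\gamma_0,\dots,\gamma_k>0$ such that $$f_0=\frac{f(1)}N+\sum_{i=0}^{k}\gamma_i f(\beta_i)\quad\text{for every real polynomial } f \text{ of degree at most } 2k.$$ Let $I\subseteq[-1,1)$ contain all $\beta_i$, and let $h$ be absolutely monotone on $[-1,1]$. Then there is exactly one polynomial $F$ of degree at most $2k$ with $F(\beta_i)=h(\beta_i)$ for $i=0,\dots,k$ and $F'(\beta_i)=h'(\beta_i)$ for $i=1,\dots,k$. It satisfies $F(t)\le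 h(t)$ for all $t\in I$, and for every real polynomial $f$ of degree at most $\tau$ with $f(t)\le h(t)$ for all $t\in I$, $$N(f_0N-f(1))\le N(F_0N-F(1))=N^2\sum_{i=0}^{k}\gamma_i h(\beta_i).$$ Thus, among polynomials of degree at most $\tau$ lying below $h$ on $I$, the Hermite interpolant $F$ gives the largest linear programming bound $N(f_0N-f(1))$. -/

import Mathlib

open Polynomial

noncomputable section

/-- The Gegenbauer polynomials `P_i^{(n)}`: `P_0 = 1`, `P_1 = t` and
`(j + n - 2) P_{j+1} = (2 j + n - 2) t P_j - j P_{j-1}` for `j ≥ 1` (here `j = i + 1`). -/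
def gegenbauer (n : ℕ) : ℕ → ℝ[X]
  | 0 => 1
  | 1 => X
  | i + 2 =>
      C (((i : ℝ) + 1 + n - 2)⁻¹) *
        (C (2 * ((i : ℝ) + 1) + n - 2) * X * gegenbauer n (i + 1)
          - C ((i : ℝ) + 1) * gegenbauer n i)

/-- `P_i^{(n)}` has degree `i` when `n ≥ 2`. -/
theorem degree_gegenbauer (n : ℕ) (hn : 2 ≤ n) (i : ℕ) : (gegenbauer n i).degree = i := by
  induction i using Nat.strong_induction_on with
  | _ i ih =>
    match i, ih with
    | 0, _ => simp [gegenbauer]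
    | 1, _ => simp [gegenbauer]
    | i + 2, ih =>
      have h1 := ih (i + 1) (by omega)
      have h0 := ih i (by omega)
      have hn' : (2 : ℝ) ≤ n := by exact_mod_cast hn
      have hi : (0 : ℝ) ≤ i := Nat.cast_nonneg i
      have ha : ((i : ℝ) + 1 + n - 2)⁻¹ ≠ 0 := inv_ne_zero (by linarith)
      have hb : 2 * ((i : ℝ) + 1) + n - 2 ≠ 0 := by linarith
      have hc : (i : ℝ) + 1 ≠ 0 := by linarith
      have e1 : (C (2 * ((i : ℝ) + 1) + n - 2) * X * gegenbauer n (i + 1)).degree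
          = ((i + 2 : ℕ) : WithBot ℕ) := by
        rw [degree_mul, degree_C_mul_X hb, h1]
        push_cast
        ring
      have e2 : (C ((i : ℝ) + 1) * gegenbauer n i).degree = (i : WithBot ℕ) := by
        rw [degree_C_mul hc, h0]
      rw [gegenbauer, degree_C_mul ha, degree_sub_eq_left_of_degree_lt, e1]
      rw [e1, e2]
      exact_mod_cast (by omega : i < i + 2)

/-- The Gegenbauer polynomials as a basis of the space of real polynomials. -/
def gegenbauerBasis (n : ℕ) (hn : 2 ≤ n) : Module.Basis ℕ ℝ ℝ[X] :=
  (Polynomial.Sequence.mk (gegenbauer n) (degree_gegenbauer n hn)).basis fun i =>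
    (leadingCoeff_ne_zero.mpr (Polynomial.Sequence.ne_zero _ i)).isUnit

/-- The Gegenbauer coefficient `f_i` in the unique expansion `f = ∑ f_i P_i^{(n)}`. -/
def gegenbauerCoeff (n : ℕ) (hn : 2 ≤ n) (f : ℝ[X]) (i : ℕ) : ℝ :=
  (gegenbauerBasis n hn).repr f i

/-- The Delsarte-Goethals-Seidel bound `D(n, τ)`, with `k = (τ + 1) / 2` for odd `τ` and
`k = τ / 2` for even `τ`. -/
def dgsBound (n τ : ℕ) : ℕ :=
  if Odd τ then 2 * (n + (τ + 1) / 2 - 2).choose (n - 1)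
  else (n + τ / 2 - 1).choose (n - 1) + (n + τ / 2 - 2).choose (n - 1)

/-- `α_0 < ⋯ < α_{k-1}` and `ρ_0, …, ρ_{k-1}` are the nodes and the weights of the Levenshtein
quadrature for `τ = 2k - 1`. -/
structure IsOddQuadrature (n : ℕ) (hn : 2 ≤ n) (N k : ℕ) (α ρ : Fin k → ℝ) : Prop where
  strictMono : StrictMono α
  neg_one_lt : ∀ i, -1 < α i
  lt_one : ∀ i, α i < 1
  weight_pos : ∀ i, 0 < ρ i
  formula : ∀ f : ℝ[X], f.natDegree ≤ 2 * k - 1 →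
    gegenbauerCoeff n hn f 0 = f.eval 1 / N + ∑ i, ρ i * f.eval (α i)

/-- `-1 = β_0 < ⋯ < β_k` and `γ_0, …, γ_k` are the nodes and the weights of the Levenshtein
quadrature for `τ = 2k`. -/
structure IsEvenQuadrature (n : ℕ) (hn : 2 ≤ n) (N k : ℕ) (β γ : Fin (k + 1) → ℝ) : Prop where
  strictMono : StrictMono β
  zero_eq : β 0 = -1
  lt_one : ∀ i, β i < 1
  weight_pos : ∀ i, 0 < γ i
  formula : ∀ f : ℝ[X], f.natDegree ≤ 2 * k →
    gegenbauerCoeff n hn f 0 = f.eval 1 / N + ∑ i, γ i * f.eval (β i)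

/-- `F` has degree at most `2k - 1` and agrees with `h` to first order at every `α_i`. -/
structure IsOddHermite (k : ℕ) (α : Fin k → ℝ) (h : ℝ → ℝ) (F : ℝ[X]) : Prop where
  natDegree_le : F.natDegree ≤ 2 * k - 1
  eval_eq : ∀ i, F.eval (α i) = h (α i)
  deriv_eq : ∀ i, F.derivative.eval (α i) = deriv h (α i)

/-- `F` has degree at most `2k`, agrees with `h` at every `β_i`, and agrees with `h` to first
order at every `β_i` with `i ≠ 0`. -/
structure IsEvenHermite (k : ℕ) (β : Fin (k + 1) → ℝ) (h : ℝ → ℝ) (F : ℝ[X]) : Prop where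
  natDegree_le : F.natDegree ≤ 2 * k
  eval_eq : ∀ i, F.eval (β i) = h (β i)
  deriv_eq : ∀ i, i ≠ 0 → F.derivative.eval (β i) = deriv h (β i)

/-- The polynomial `f` satisfies `f(t) ≤ h(t)` for all `t ∈ I`. -/
def IsBelowOn (I : Set ℝ) (h : ℝ → ℝ) (f : ℝ[X]) : Prop :=
  ∀ t ∈ I, f.eval t ≤ h t

/-- The linear programming bound `N (f_0 N - f(1))` given by the polynomial `f`. -/
def lpBound (n : ℕ) (hn : 2 ≤ n) (N : ℕ) (f : ℝ[X]) : ℝ :=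
  N * (gegenbauerCoeff n hn f 0 * N - f.eval 1)

end

/-! Put `L f = f_0 - f(1)/N`. A quadrature formula for `L` with positive weights turns the bound
`N(f_0 N - f(1))` into `N²` times a positive combination of the values of `f` at the nodes. Hence `f
≤ h` at the nodes gives the upper bound, and a polynomial in the exactness range that equals `h`
there attains it. It remains to build the quadrature and to show that the Hermite interpolant stays
below `h`.

The quadrature is Gauss quadrature, for `L` when `τ = 2k-1` and for `g ↦ L((1+X)g)` when `τ = 2k`,
where the node `-1` is added afterwards. It needs positivity of the functional on `(1 ∓ X)p²` for
`deg p < k`. In Gegenbauer coordinates `f ↦ f_0` takes `(1 ± X)p²` to an explicit sum of squares,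
and Cauchy-Schwarz bounds `p(1)²` by this mean; the condition `D(n,τ) < N` is what makes the
subtracted term `f(1)/N` smaller than the mean.

For the inequality, Rolle's theorem gives `h(t) - F(t) = h^(d)(ξ)/d! · W(t)` off the nodes, where
`d` counts the nodes with multiplicity. The nodal polynomial `W` is a square, or `t + 1` times a
square, and `h^(d) ≥ 0`. -/

open Polynomial

/-! ### Gauss quadrature for positive functionals on polynomials -/

/-- A functional that is positive on squares of nonzero polynomials of degree less than `k` has a
monic orthogonal polynomial of degree `k`. -/
theorem exists_monic_orthogonal (M : ℝ[X] →ₗ[ℝ] ℝ) (k : ℕ)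
    (hM : ∀ p : ℝ[X], p ≠ 0 → p.degree < k → 0 < M (p ^ 2)) :
    ∃ q : ℝ[X], q.Monic ∧ q.natDegree = k ∧ ∀ p : ℝ[X], p.degree < k → M (q * p) = 0 := by
  let B : ℝ[X] →ₗ[ℝ] ℝ[X] →ₗ[ℝ] ℝ := (LinearMap.mul ℝ ℝ[X]).compr₂ M
  let T : degreeLT ℝ k →ₗ[ℝ] Module.Dual ℝ (degreeLT ℝ k) := B.domRestrict₁₂ _ _
  have hT : ∀ a b, T a b = M (a.1 * b.1) := fun a b => rfl
  have hinj : Function.Injective T := by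
    rw [← LinearMap.ker_eq_bot, LinearMap.ker_eq_bot']
    intro a ha
    by_contra hne
    have h1 := hM a.1 (fun h => hne (Subtype.ext h)) (mem_degreeLT.mp a.2)
    have h2 : T a a = 0 := by rw [ha]; rfl
    rw [hT, ← pow_two] at h2
    exact h1.ne' h2
  have : FiniteDimensional ℝ (degreeLT ℝ k) :=
    Module.Finite.equiv (degreeLTEquiv ℝ k).symm
  have hsurj := (LinearMap.injective_iff_surjective_of_finrank_eq_finrank
    (Subspace.dual_finrank_eq (K := ℝ) (V := degreeLT ℝ k)).symm).mp hinj
  -- `r` is the orthogonal projection of `X ^ k` to degree less than `k`; it exists because the form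
  -- is nondegenerate there.
  obtain ⟨r, hr⟩ := hsurj ((B (X ^ k)).domRestrict _)
  have hdeg : r.1.degree < k := mem_degreeLT.mp r.2
  have hmon : (X ^ k - r.1).Monic := monic_X_pow_sub hdeg
  refine ⟨X ^ k - r.1, hmon, ?_, fun p hp => ?_⟩
  · apply natDegree_eq_of_degree_eq_some
    rw [degree_sub_eq_left_of_degree_lt (by rwa [degree_X_pow]), degree_X_pow]
  · have h1 := LinearMap.congr_fun hr ⟨p, mem_degreeLT.mpr hp⟩
    have h2 : M (r.1 * p) = M (X ^ k * p) := h1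
    rw [sub_mul, map_sub, h2, sub_self]

section Orthogonal

variable {M : ℝ[X] →ₗ[ℝ] ℝ} {k : ℕ} {q : ℝ[X]}

theorem eq_of_monic_orthogonal (hM : ∀ p : ℝ[X], p ≠ 0 → p.degree < k → 0 < M (p ^ 2))
    {q' : ℝ[X]} (hq : q.Monic) (hqk : q.natDegree = k)
    (horth : ∀ p : ℝ[X], p.degree < k → M (q * p) = 0) (hq' : q'.Monic)
    (hqk' : q'.natDegree = k) (horth' : ∀ p : ℝ[X], p.degree < k → M (q' * p) = 0) :
    q = q' := by
  by_contra hne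
  have hd : q.degree = q'.degree := by
    rw [degree_eq_natDegree hq.ne_zero, degree_eq_natDegree hq'.ne_zero, hqk, hqk']
  have hlt : (q - q').degree < k := by
    have := degree_sub_lt_left hd hq.ne_zero (by rw [hq.leadingCoeff, hq'.leadingCoeff])
    rwa [degree_eq_natDegree hq.ne_zero, hqk] at this
  have h1 := hM _ (sub_ne_zero.mpr hne) hlt
  rw [pow_two, sub_mul, map_sub, horth _ hlt, horth' _ hlt, sub_self] at h1
  exact lt_irrefl _ h1

/-- If the quadratic times `s` were `q`, then `M (q * s)` would be `M (((X - a)s)²) + d² M (s²) >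
0`, against orthogonality. The case `d = 0` excludes multiple roots, and `d ≠ 0` excludes pairs of
conjugate roots. -/
theorem not_quadratic_dvd_orthogonal
    (hM : ∀ p : ℝ[X], p ≠ 0 → p.degree < k → 0 < M (p ^ 2)) (hq : q.Monic)
    (hqk : q.natDegree = k) (horth : ∀ p : ℝ[X], p.degree < k → M (q * p) = 0) (a d : ℝ) :
    ¬ ((X - C a) ^ 2 + C (d ^ 2)) ∣ q := by
  rintro ⟨s, hs⟩
  have hs0 : s ≠ 0 := by rintro rfl; exact hq.ne_zero (by simpa using hs)
  have h2 : ((X - C a) ^ 2 + C (d ^ 2)).natDegree = 2 := by compute_degree!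
  have hne : ((X - C a) ^ 2 + C (d ^ 2)) ≠ 0 := by
    rintro h; rw [h, natDegree_zero] at h2; omega
  have hk : k = 2 + s.natDegree := by rw [← hqk, hs, natDegree_mul hne hs0, h2]
  have hsd : s.degree < k := by
    rw [degree_eq_natDegree hs0]; exact_mod_cast (by omega)
  have hne' : (X - C a) * s ≠ 0 := mul_ne_zero (X_sub_C_ne_zero a) hs0
  have hsd' : ((X - C a) * s).degree < (k : WithBot ℕ) := by
    rw [degree_eq_natDegree hne', natDegree_mul (X_sub_C_ne_zero a) hs0, natDegree_X_sub_C]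
    exact_mod_cast (by omega)
  have e : q * s = ((X - C a) * s) ^ 2 + d ^ 2 • s ^ 2 := by
    rw [smul_eq_C_mul, hs]; ring
  have h0 := horth s hsd
  rw [e, map_add, map_smul, smul_eq_mul] at h0
  have := hM _ hne' hsd'
  have := hM _ hs0 hsd
  nlinarith [sq_nonneg d, mul_nonneg (sq_nonneg d) this.le]

theorem card_roots_orthogonal
    (hM : ∀ p : ℝ[X], p ≠ 0 → p.degree < k → 0 < M (p ^ 2)) (hq : q.Monic)
    (hqk : q.natDegree = k) (horth : ∀ p : ℝ[X], p.degree < k → M (q * p) = 0) :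
    q.roots.toFinset.card = k := by
  have hnd : q.roots.Nodup := by
    rw [Multiset.nodup_iff_count_le_one]
    intro a
    by_contra! h
    rw [count_roots] at h
    apply not_quadratic_dvd_orthogonal hM hq hqk horth a 0
    have : (X - C a) ^ 2 ∣ q := (le_rootMultiplicity_iff hq.ne_zero).mp h
    simpa using this
  rw [Multiset.toFinset_card_of_nodup hnd, ← hqk]
  obtain ⟨s, hs, hcard, hs0⟩ := exists_prod_multiset_X_sub_C_mul q
  by_contra hne
  have hs1 : s.natDegree ≠ 0 := by omega
  have hsne : s ≠ 0 := by rintro rfl; simp at hs1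
  obtain ⟨z, hz⟩ := IsAlgClosed.exists_aeval_eq_zero ℂ s
    (by rw [degree_eq_natDegree hsne]; exact_mod_cast hs1)
  by_cases him : z.im = 0
  · have hzr : z = algebraMap ℝ ℂ z.re := by apply Complex.ext <;> simp [him]
    rw [hzr, aeval_algebraMap_apply] at hz
    have hr : s.eval z.re = 0 := by
      have := (algebraMap ℝ ℂ).injective (hz.trans (map_zero _).symm)
      simpa using this
    have : z.re ∈ s.roots := (mem_roots hsne).mpr hr
    rw [hs0] at this
    simp at this
  · have hdvd := quadratic_dvd_of_aeval_eq_zero_im_ne_zero s hz him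
    apply not_quadratic_dvd_orthogonal hM hq hqk horth z.re z.im
    have e : (X - C z.re) ^ 2 + C (z.im ^ 2) = X ^ 2 - C (2 * z.re) * X + C (‖z‖ ^ 2) := by
      rw [Complex.sq_norm, Complex.normSq_apply]
      simp only [map_add, map_mul, map_pow, map_ofNat]
      ring
    rw [e]
    exact hdvd.trans ⟨_, by rw [mul_comm]; exact hs.symm⟩

/-- With `q = (X - x)s`, orthogonality to `s` says that `x` is the mean of `X` for the positive
weight `s²`; positivity of `1 ∓ X` confines this mean to `(-1, 1)`. -/
theorem root_mem_Ioo_of_orthogonal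
    (h1 : ∀ p : ℝ[X], p ≠ 0 → p.degree < k → 0 < M ((1 - X) * p ^ 2))
    (h2 : ∀ p : ℝ[X], p ≠ 0 → p.degree < k → 0 < M ((1 + X) * p ^ 2)) (hq : q.Monic)
    (hqk : q.natDegree = k) (horth : ∀ p : ℝ[X], p.degree < k → M (q * p) = 0) {x : ℝ}
    (hx : q.IsRoot x) : x ∈ Set.Ioo (-1 : ℝ) 1 := by
  obtain ⟨s, hs⟩ := dvd_iff_isRoot.mpr hx
  have hs0 : s ≠ 0 := by rintro rfl; exact hq.ne_zero (by simpa using hs)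
  have hk : k = 1 + s.natDegree := by
    rw [← hqk, hs, natDegree_mul (X_sub_C_ne_zero x) hs0, natDegree_X_sub_C]
  have hsd : s.degree < k := by
    rw [degree_eq_natDegree hs0]; exact_mod_cast (by omega)
  have p1 := h1 s hs0 hsd
  have p2 := h2 s hs0 hsd
  have h0 := horth s hsd
  have e : q * s = X * s ^ 2 - x • s ^ 2 := by rw [smul_eq_C_mul, hs]; ring
  rw [e, map_sub, map_smul, smul_eq_mul] at h0
  rw [sub_mul, one_mul, map_sub] at p1
  rw [add_mul, one_mul, map_add] at p2
  constructor <;> nlinarith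

end Orthogonal

theorem map_sq_pos_of_one_sub_of_one_add {M : ℝ[X] →ₗ[ℝ] ℝ} {k : ℕ}
    (h1 : ∀ p : ℝ[X], p ≠ 0 → p.degree < k → 0 < M ((1 - X) * p ^ 2))
    (h2 : ∀ p : ℝ[X], p ≠ 0 → p.degree < k → 0 < M ((1 + X) * p ^ 2))
    (p : ℝ[X]) (hp : p ≠ 0) (hpk : p.degree < k) : 0 < M (p ^ 2) := by
  have p1 := h1 p hp hpk
  have p2 := h2 p hp hpk
  rw [sub_mul, one_mul, map_sub] at p1
  rw [add_mul, one_mul, map_add] at p2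
  linarith

/-- Gauss quadrature with nodes in `(-1, 1)`. -/
theorem exists_gauss_quadrature (M : ℝ[X] →ₗ[ℝ] ℝ) (k : ℕ)
    (h1 : ∀ p : ℝ[X], p ≠ 0 → p.degree < k → 0 < M ((1 - X) * p ^ 2))
    (h2 : ∀ p : ℝ[X], p ≠ 0 → p.degree < k → 0 < M ((1 + X) * p ^ 2)) :
    ∃ α w : Fin k → ℝ, StrictMono α ∧ (∀ i, α i ∈ Set.Ioo (-1 : ℝ) 1) ∧ (∀ i, 0 < w i) ∧
      ∀ f : ℝ[X], f.degree < (2 * k : ℕ) → M f = ∑ i, w i * f.eval (α i) := by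
  have hM := map_sq_pos_of_one_sub_of_one_add h1 h2
  obtain ⟨q, hq, hqk, horth⟩ := exists_monic_orthogonal M k hM
  have hcard := card_roots_orthogonal hM hq hqk horth
  set α : Fin k → ℝ := fun i => q.roots.toFinset.orderEmbOfFin hcard i
  have hα : StrictMono α := (q.roots.toFinset.orderEmbOfFin hcard).strictMono
  have hroot : ∀ i, q.eval (α i) = 0 := fun i => by
    have := Finset.orderEmbOfFin_mem q.roots.toFinset hcard i
    rw [Multiset.mem_toFinset, mem_roots hq.ne_zero] at this
    exact this
  have hlow : ∀ f : ℝ[X], f.degree < k →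
      M f = ∑ i, M (Lagrange.basis Finset.univ α i) * f.eval (α i) := by
    intro f hf
    have := Lagrange.eq_interpolate (s := Finset.univ) (v := α) (f := f) hα.injective.injOn
      (by simpa using hf)
    conv_lhs => rw [this, Lagrange.interpolate_apply]
    rw [map_sum]
    refine Finset.sum_congr rfl fun i _ => ?_
    rw [← smul_eq_C_mul, map_smul, smul_eq_mul, mul_comm]
  have hall : ∀ f : ℝ[X], f.degree < (2 * k : ℕ) →
      M f = ∑ i, M (Lagrange.basis Finset.univ α i) * f.eval (α i) := by
    intro f hf
    have hmod : (f %ₘ q).degree < k := by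
      have := degree_modByMonic_lt f hq
      rwa [degree_eq_natDegree hq.ne_zero, hqk] at this
    have hdiv : (f /ₘ q).degree < k := by
      rcases eq_or_ne (f /ₘ q) 0 with h | h
      · rw [h, degree_zero]; exact WithBot.bot_lt_coe _
      · rcases eq_or_ne f 0 with rfl | hf0
        · simp at h
        rw [← natDegree_lt_iff_degree_lt h, natDegree_divByMonic f hq, hqk]
        rw [← natDegree_lt_iff_degree_lt hf0] at hf
        have : k ≠ 0 := by omega
        omega
    -- Orthogonality kills the multiple of `q`, which also vanishes at the nodes; only the
    -- remainder, of degree less than `k`, matters on either side.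
    have e := modByMonic_add_div f q
    have hMf : M f = M (f %ₘ q) := by
      conv_lhs => rw [← e, map_add, horth _ hdiv, add_zero]
    rw [hMf, hlow _ hmod]
    refine Finset.sum_congr rfl fun i _ => ?_
    congr 1
    conv_rhs => rw [← e, eval_add, eval_mul, hroot, zero_mul, add_zero]
  refine ⟨α, fun i => M (Lagrange.basis Finset.univ α i), hα, fun i =>
    root_mem_Ioo_of_orthogonal h1 h2 hq hqk horth (hroot i), fun i => ?_, hall⟩
  have hbd : (Lagrange.basis Finset.univ α i).degree = (k - 1 : ℕ) := by
    rw [Lagrange.degree_basis hα.injective.injOn (Finset.mem_univ i)]; simp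
  have hk : 0 < k := i.pos
  have hb0 : Lagrange.basis Finset.univ α i ≠ 0 := by
    intro h; rw [h, degree_zero] at hbd; exact WithBot.bot_ne_coe hbd
  -- The square of a Lagrange basis polynomial has degree `2k - 2`, so the formula applies to it and
  -- isolates one weight.
  have hpos := hM _ hb0 (by rw [hbd]; exact_mod_cast (by omega))
  rw [hall _ (by rw [pow_two, degree_mul, hbd]; norm_cast; omega),
    Finset.sum_eq_single i] at hpos
  · simpa [Lagrange.eval_basis_self hα.injective.injOn (Finset.mem_univ i)] using hpos
  · intro j _ hji
    rw [eval_pow, Lagrange.eval_basis_of_ne hji.symm (Finset.mem_univ j)]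
    simp
  · simp

/-- Exactness makes the nodal polynomial orthogonal to all lower degrees, so it is the unique monic
orthogonal polynomial and fixes the nodes; Lagrange basis polynomials then read off the weights. -/
theorem gauss_quadrature_unique {M : ℝ[X] →ₗ[ℝ] ℝ} {k : ℕ}
    (hM : ∀ p : ℝ[X], p ≠ 0 → p.degree < k → 0 < M (p ^ 2)) {α w α' w' : Fin k → ℝ}
    (hα : StrictMono α) (hα' : StrictMono α')
    (h : ∀ f : ℝ[X], f.degree < (2 * k : ℕ) → M f = ∑ i, w i * f.eval (α i))
    (h' : ∀ f : ℝ[X], f.degree < (2 * k : ℕ) → M f = ∑ i, w' i * f.eval (α' i)) :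
    α' = α ∧ w' = w := by
  have key : ∀ a v : Fin k → ℝ,
      (∀ f : ℝ[X], f.degree < (2 * k : ℕ) → M f = ∑ i, v i * f.eval (a i)) →
      ∀ p : ℝ[X], p.degree < k → M (Lagrange.nodal Finset.univ a * p) = 0 := by
    intro a v hv p hp
    rw [hv]
    · refine Finset.sum_eq_zero fun i _ => ?_
      rw [eval_mul, Lagrange.eval_nodal_at_node (Finset.mem_univ i)]; simp
    · rcases eq_or_ne p 0 with rfl | hp0
      · rw [mul_zero, degree_zero]; exact WithBot.bot_lt_coe _
      rw [degree_mul, Lagrange.degree_nodal, Finset.card_univ, Fintype.card_fin]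
      rw [degree_eq_natDegree hp0] at hp ⊢
      norm_cast at hp ⊢
      omega
  have hnod : Lagrange.nodal Finset.univ α = Lagrange.nodal Finset.univ α' :=
    eq_of_monic_orthogonal hM (Lagrange.nodal_monic) (by simp) (key α w h)
      (Lagrange.nodal_monic) (by simp) (key α' w' h')
  have hr : Set.range α' = Set.range α := by
    have hz : ∀ a : Fin k → ℝ, Set.range a = {x | (Lagrange.nodal Finset.univ a).eval x = 0} := by
      intro a
      ext x
      simp only [Set.mem_range, Set.mem_ofPred_eq, Lagrange.eval_nodal, Finset.prod_eq_zero_iff,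
        Finset.mem_univ, true_and, sub_eq_zero]
      exact exists_congr fun i => eq_comm
    rw [hz, hz, hnod]
  obtain rfl : α' = α := (hα'.range_inj hα).mp hr
  refine ⟨rfl, funext fun i => ?_⟩
  have hbd : (Lagrange.basis Finset.univ α' i).degree < (2 * k : ℕ) := by
    have := i.pos
    rw [Lagrange.degree_basis hα.injective.injOn (Finset.mem_univ i)]
    simp only [Finset.card_univ, Fintype.card_fin]
    exact_mod_cast (by omega)
  have hv : ∀ v : Fin k → ℝ, ∑ j, v j * (Lagrange.basis Finset.univ α' i).eval (α' j) = v i := by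
    intro v
    rw [Finset.sum_eq_single i]
    · rw [Lagrange.eval_basis_self hα.injective.injOn (Finset.mem_univ i), mul_one]
    · intro j _ hji
      rw [Lagrange.eval_basis_of_ne hji.symm (Finset.mem_univ j), mul_zero]
    · simp
  rw [← hv w', ← hv w, ← h _ hbd, ← h' _ hbd]

/-! ### Gegenbauer orthogonality and positivity of the mean -/

/-- Weights of the edges of the Gegenbauer Jacobi matrix, in dimension `m + 2`, with
`edgeWeight m 0 = 0`. -/
def edgeWeight (m : ℕ) : ℕ → ℝ
  | 0 => 0
  | i + 1 => ((m + i).choose m : ℝ)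

/-- The dimension of the space of harmonic polynomials of degree `i` in `m + 2` variables. -/
def harmonicDim (m i : ℕ) : ℝ := edgeWeight m i + edgeWeight m (i + 1)

theorem edgeWeight_nonneg (m i : ℕ) : 0 ≤ edgeWeight m i := by
  cases i
  · exact le_rfl
  · exact Nat.cast_nonneg _

theorem edgeWeight_succ_pos (m i : ℕ) : 0 < edgeWeight m (i + 1) := by
  exact Nat.cast_pos.mpr (Nat.choose_pos (by omega))

theorem harmonicDim_pos (m i : ℕ) : 0 < harmonicDim m i :=
  add_pos_of_nonneg_of_pos (edgeWeight_nonneg m i) (edgeWeight_succ_pos m i)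

theorem edgeWeight_succ_mul (m i : ℕ) :
    (i : ℝ) * edgeWeight m (i + 1) = (m + i) * edgeWeight m i := by
  cases i with
  | zero => simp [edgeWeight]
  | succ i =>
    have h := Nat.add_one_mul_choose_eq (m + i) m
    have h' := Nat.choose_succ_right_eq (m + i + 1) m
    have h3 : (m + i + 1).choose m * (i + 1) = (m + i + 1) * (m + i).choose m := by
      rw [h, h']; congr 1; omega
    simp only [edgeWeight]
    rw [mul_comm]
    exact_mod_cast h3

theorem sum_edgeWeight (m k : ℕ) :
    ∑ i ∈ Finset.range k, edgeWeight m (i + 1) = ((m + k).choose (m + 1) : ℝ) := by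
  induction k with
  | zero => simp
  | succ k ih =>
    rw [Finset.sum_range_succ, ih, edgeWeight, ← add_assoc, Nat.choose_succ_succ]
    push_cast; ring

/-- The recurrence in reversible form: multiplication by `X` is the random walk on a path with these
edge weights, the vertex weight `harmonicDim` being the sum of the two adjacent edges. -/
theorem gegenbauer_three_term (m i : ℕ) :
    C (harmonicDim m (i + 1)) * (X * gegenbauer (m + 2) (i + 1)) =
      C (edgeWeight m (i + 2)) * gegenbauer (m + 2) (i + 2)
        + C (edgeWeight m (i + 1)) * gegenbauer (m + 2) i := by
  have hE := edgeWeight_succ_mul m (i + 1)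
  push_cast at hE
  have hpos : (0 : ℝ) < m + i + 1 := by positivity
  have hi : (0 : ℝ) < i + 1 := by positivity
  have e1 : edgeWeight m (i + 2) = (m + i + 1) / (i + 1) * edgeWeight m (i + 1) := by
    field_simp; linarith
  have e2 : edgeWeight m (i + 2) * ((i : ℝ) + 1 + (m + 2 : ℕ) - 2)⁻¹ =
      edgeWeight m (i + 1) / (i + 1) := by
    rw [e1]; push_cast
    have : (i : ℝ) + 1 + (m + 2) - 2 ≠ 0 := by linarith
    field_simp; ring
  have h1 : edgeWeight m (i + 2) * ((i : ℝ) + 1 + (m + 2 : ℕ) - 2)⁻¹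
      * (2 * ((i : ℝ) + 1) + (m + 2 : ℕ) - 2) = harmonicDim m (i + 1) := by
    rw [e2, harmonicDim, e1]; push_cast; field_simp; ring
  have h2 : edgeWeight m (i + 2) * ((i : ℝ) + 1 + (m + 2 : ℕ) - 2)⁻¹
      * ((i : ℝ) + 1) = edgeWeight m (i + 1) := by
    rw [e2]; field_simp
  conv_rhs => rw [gegenbauer]
  conv_rhs => rw [← h2]
  rw [← h1]
  simp only [map_mul]
  ring

theorem gegenbauer_eval_one (m i : ℕ) : (gegenbauer (m + 2) i).eval 1 = 1 := by
  induction i using Nat.strong_induction_on with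
  | _ i ih =>
    match i, ih with
    | 0, _ => simp [gegenbauer]
    | 1, _ => simp [gegenbauer]
    | i + 2, ih =>
      have h := congrArg (eval 1) (gegenbauer_three_term m i)
      simp only [eval_mul, eval_add, eval_C, eval_X, ih (i + 1) (by omega), ih i (by omega),
        harmonicDim] at h
      have hp := edgeWeight_succ_pos m (i + 1)
      exact mul_left_cancel₀ hp.ne' (by linarith)

/-- The functional `f ↦ f_0`. -/
noncomputable def gegenbauerMean (n : ℕ) (hn : 2 ≤ n) : ℝ[X] →ₗ[ℝ] ℝ :=
  (gegenbauerBasis n hn).coord 0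

theorem gegenbauerBasis_apply (n : ℕ) (hn : 2 ≤ n) (i : ℕ) :
    gegenbauerBasis n hn i = gegenbauer n i := by
  simp [gegenbauerBasis]

theorem gegenbauerMean_gegenbauer (n : ℕ) (hn : 2 ≤ n) (i : ℕ) :
    gegenbauerMean n hn (gegenbauer n i) = if i = 0 then 1 else 0 := by
  rw [← gegenbauerBasis_apply n hn, gegenbauerMean, Module.Basis.coord_apply,
    Module.Basis.repr_self, Finsupp.single_apply]

/-- Three-term recurrence for all indices; the term with `edgeWeight m 0 = 0` is immaterial. -/
theorem gegenbauer_mul_X (m i : ℕ) :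
    X * gegenbauer (m + 2) i = (edgeWeight m (i + 1) / harmonicDim m i) • gegenbauer (m + 2) (i + 1)
        + (edgeWeight m i / harmonicDim m i) • gegenbauer (m + 2) (i - 1) := by
  cases i with
  | zero => simp [gegenbauer, edgeWeight, harmonicDim]
  | succ i =>
    have h := harmonicDim_pos m (i + 1)
    have e := gegenbauer_three_term m i
    rw [← smul_eq_C_mul, ← smul_eq_C_mul, ← smul_eq_C_mul] at e
    apply smul_right_injective ℝ[X] h.ne'
    simp only [smul_add, smul_smul, mul_div_cancel₀ _ h.ne', e, Nat.add_sub_cancel]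

/-- Orthogonality without an integral: `X` is moved from one factor to the other, the recurrence is
expanded on both sides, and the result is solved for the product with index `i + 1`. -/
theorem gegenbauerMean_mul (m : ℕ) (hn : 2 ≤ m + 2) (i j : ℕ) :
    gegenbauerMean (m + 2) hn (gegenbauer (m + 2) i * gegenbauer (m + 2) j) =
      if i = j then (harmonicDim m i)⁻¹ else 0 := by
  induction i using Nat.strong_induction_on generalizing j with
  | _ i ih =>
    match i, ih with
    | 0, _ =>
      rw [gegenbauer, one_mul, gegenbauerMean_gegenbauer]
      by_cases h : j = 0
      · subst h; simp [harmonicDim, edgeWeight]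
      · simp [h, Ne.symm h]
    | i + 1, ih =>
      set L := gegenbauerMean (m + 2) hn
      set P := gegenbauer (m + 2)
      have hp := edgeWeight_succ_pos m i
      have hr := harmonicDim_pos m i
      have e : L (X * P i * P j) = L (P i * (X * P j)) := by congr 1; ring
      rw [gegenbauer_mul_X, gegenbauer_mul_X, add_mul, mul_add, map_add, map_add,
        smul_mul_assoc, smul_mul_assoc, mul_smul_comm, mul_smul_comm, map_smul, map_smul,
        map_smul, map_smul, ih i (by omega), ih i (by omega)] at e
      simp only [smul_eq_mul] at e
      have key : ∀ x : ℝ, edgeWeight m (i + 1) / harmonicDim m i * L (P (i + 1) * P j) =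
          edgeWeight m (i + 1) / harmonicDim m i * x → L (P (i + 1) * P j) = x := fun x h =>
        mul_left_cancel₀ (div_pos hp hr).ne' h
      -- At `i = 0` the truncated index `i - 1` is not covered by induction, but its coefficient
      -- `edgeWeight m 0` is zero.
      have hlast : edgeWeight m i / harmonicDim m i * L (P (i - 1) * P j) =
          edgeWeight m i / harmonicDim m i *
            if i - 1 = j then (harmonicDim m (i - 1))⁻¹ else 0 := by
        rcases Nat.eq_zero_or_pos i with h | h
        · subst h; simp [edgeWeight]
        · rw [ih (i - 1) (by omega)]
      rw [hlast] at e
      apply key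
      rw [eq_sub_of_add_eq e]
      rcases eq_or_ne j (i + 1) with rfl | h1
      · have := harmonicDim_pos m (i + 1)
        rw [if_neg (by omega), if_pos (by omega), if_neg (by omega), if_pos rfl]
        field_simp; ring
      · rw [if_neg (Ne.symm h1)]
        rcases eq_or_ne i (j + 1) with rfl | h2
        · have := harmonicDim_pos m j
          have := harmonicDim_pos m (j + 1)
          rw [if_pos rfl, if_neg (by omega), if_pos (by omega), Nat.add_sub_cancel]
          field_simp; ring
        · rw [if_neg h2]
          rcases Nat.eq_zero_or_pos j with h | h
          · subst h
            rcases Nat.eq_zero_or_pos i with h | h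
            · subst h; simp [edgeWeight]
            · rw [if_neg (by omega : ¬i - 1 = 0)]; simp [edgeWeight]
          · rw [if_neg (by omega), if_neg (by omega)]; ring

/-- Expansion in the Gegenbauer polynomials, normalised by `harmonicDim`. -/
theorem exists_gegenbauer_coords (m k : ℕ) (p : ℝ[X]) (hp : p.degree < k) :
    ∃ u : ℕ → ℝ, (∀ i, k ≤ i → u i = 0) ∧
      p = ∑ i ∈ Finset.range k, (u i * harmonicDim m i) • gegenbauer (m + 2) i := by
  induction k generalizing p with
  | zero =>
    have : p = 0 := by
      by_contra h
      rw [degree_eq_natDegree h] at hp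
      norm_cast at hp
    exact ⟨0, fun _ _ => rfl, by simpa using this⟩
  | succ k ih =>
    set P := gegenbauer (m + 2) k
    have hdeg : P.degree = k := degree_gegenbauer (m + 2) (by omega) k
    have hP0 : P ≠ 0 := by rintro h; rw [h, degree_zero] at hdeg; exact WithBot.bot_ne_coe hdeg
    have hPn : P.natDegree = k := natDegree_eq_of_degree_eq_some hdeg
    have hlc : P.coeff k ≠ 0 := by rw [← hPn]; exact leadingCoeff_ne_zero.mpr hP0
    set c := p.coeff k / P.coeff k
    have hlow : (p - c • P).degree < k := by
      rw [degree_lt_iff_coeff_zero]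
      intro j hj
      rw [coeff_sub, coeff_smul, smul_eq_mul]
      rcases hj.eq_or_lt with rfl | hj
      · rw [div_mul_cancel₀ _ hlc, sub_self]
      · rw [coeff_eq_zero_of_degree_lt (hp.trans_le (by exact_mod_cast hj)),
          coeff_eq_zero_of_degree_lt (by rw [hdeg]; exact_mod_cast hj), mul_zero, sub_zero]
    obtain ⟨u, hu, e⟩ := ih _ hlow
    refine ⟨Function.update u k (c / harmonicDim m k), fun i hi => ?_, ?_⟩
    · rw [Function.update_of_ne (by omega), hu i (by omega)]
    · rw [Finset.sum_range_succ, Function.update_self, div_mul_cancel₀ _ (harmonicDim_pos m k).ne',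
        ← sub_eq_iff_eq_add, e]
      refine Finset.sum_congr rfl fun i hi => ?_
      rw [Function.update_of_ne (Finset.mem_range.mp hi).ne]

theorem sum_range_shift (g : ℕ → ℝ) (k : ℕ) (h0 : g 0 = 0) (hk : g k = 0) :
    ∑ i ∈ Finset.range k, g i = ∑ i ∈ Finset.range k, g (i + 1) := by
  have h1 := Finset.sum_range_succ g k
  rw [Finset.sum_range_succ', h0, hk] at h1
  linarith

section Coords

variable {m k : ℕ} {u : ℕ → ℝ} {p : ℝ[X]}

theorem eval_one_of_coords
    (hp : p = ∑ i ∈ Finset.range k, (u i * harmonicDim m i) • gegenbauer (m + 2) i) :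
    p.eval 1 = ∑ i ∈ Finset.range k, u i * harmonicDim m i := by
  simp [hp, eval_finsetSum, gegenbauer_eval_one]

theorem gegenbauerMean_mul_of_coords (hn : 2 ≤ m + 2) (hu : ∀ i, k ≤ i → u i = 0)
    (hp : p = ∑ i ∈ Finset.range k, (u i * harmonicDim m i) • gegenbauer (m + 2) i) (j : ℕ) :
    gegenbauerMean (m + 2) hn (gegenbauer (m + 2) j * p) = u j := by
  simp only [hp, Finset.mul_sum, map_sum, mul_smul_comm, map_smul, gegenbauerMean_mul,
    smul_eq_mul, mul_ite, mul_zero, Finset.sum_ite_eq, Finset.mem_range]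
  split_ifs with h
  · rw [mul_assoc, mul_inv_cancel₀ (harmonicDim_pos m j).ne', mul_one]
  · exact (hu j (by omega)).symm

theorem gegenbauerMean_sq_of_coords (hn : 2 ≤ m + 2) (hu : ∀ i, k ≤ i → u i = 0)
    (hp : p = ∑ i ∈ Finset.range k, (u i * harmonicDim m i) • gegenbauer (m + 2) i) :
    gegenbauerMean (m + 2) hn (p ^ 2) = ∑ i ∈ Finset.range k, harmonicDim m i * u i ^ 2 := by
  have e : p ^ 2 = ∑ i ∈ Finset.range k,
      (u i * harmonicDim m i) • (gegenbauer (m + 2) i * p) := by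
    conv_lhs => rw [pow_two]; enter [1]; rw [hp]
    rw [Finset.sum_mul]
    simp only [smul_mul_assoc]
  rw [e, map_sum]
  refine Finset.sum_congr rfl fun i _ => ?_
  rw [map_smul, gegenbauerMean_mul_of_coords hn hu hp, smul_eq_mul]
  ring

theorem gegenbauerMean_X_mul_sq_of_coords (hn : 2 ≤ m + 2) (hu : ∀ i, k ≤ i → u i = 0)
    (hp : p = ∑ i ∈ Finset.range k, (u i * harmonicDim m i) • gegenbauer (m + 2) i) :
    gegenbauerMean (m + 2) hn (X * p ^ 2) =
      ∑ i ∈ Finset.range k, 2 * (edgeWeight m (i + 1) * (u i * u (i + 1))) := by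
  have e : X * p ^ 2 = ∑ i ∈ Finset.range k,
      ((u i * edgeWeight m (i + 1)) • (gegenbauer (m + 2) (i + 1) * p) +
        (u i * edgeWeight m i) • (gegenbauer (m + 2) (i - 1) * p)) := by
    have h : X * p ^ 2 = (∑ i ∈ Finset.range k,
        (u i * harmonicDim m i) • (X * gegenbauer (m + 2) i)) * p := by
      conv_lhs => rw [pow_two, ← mul_assoc]; enter [1, 2]; rw [hp]
      rw [Finset.mul_sum]
      simp only [mul_smul_comm]
    rw [h, Finset.sum_mul]
    refine Finset.sum_congr rfl fun i _ => ?_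
    have hr := (harmonicDim_pos m i).ne'
    rw [gegenbauer_mul_X, smul_add, smul_smul, smul_smul, add_mul, smul_mul_assoc,
      smul_mul_assoc]
    congr 2 <;> field_simp
  rw [e, map_sum]
  simp only [map_add, map_smul, gegenbauerMean_mul_of_coords hn hu hp, smul_eq_mul]
  rw [Finset.sum_add_distrib,
    sum_range_shift (fun i => u i * edgeWeight m i * u (i - 1)) k (by simp [edgeWeight])
      (by simp [hu k le_rfl]), ← Finset.sum_add_distrib]
  refine Finset.sum_congr rfl fun i _ => ?_
  rw [Nat.add_sub_cancel]
  ring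

/-- Each `harmonicDim` is split into its two edges; after an index shift both ends of an edge meet
the cross term from `X` and complete a square. -/
theorem gegenbauerMean_one_add_mul_sq_of_coords (hn : 2 ≤ m + 2) (hu : ∀ i, k ≤ i → u i = 0)
    (hp : p = ∑ i ∈ Finset.range k, (u i * harmonicDim m i) • gegenbauer (m + 2) i)
    (ε : ℝ) (hε : ε ^ 2 = 1) :
    gegenbauerMean (m + 2) hn ((1 + C ε * X) * p ^ 2) =
      ∑ i ∈ Finset.range k, edgeWeight m (i + 1) * (u i + ε * u (i + 1)) ^ 2 := by
  rw [add_mul, one_mul, mul_assoc, ← smul_eq_C_mul, map_add, map_smul,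
    gegenbauerMean_sq_of_coords hn hu hp, gegenbauerMean_X_mul_sq_of_coords hn hu hp, smul_eq_mul]
  simp only [harmonicDim, add_mul, Finset.sum_add_distrib]
  rw [sum_range_shift (fun i => edgeWeight m i * u i ^ 2) k (by simp [edgeWeight])
    (by simp [hu k le_rfl]), Finset.mul_sum, ← Finset.sum_add_distrib, ← Finset.sum_add_distrib]
  refine Finset.sum_congr rfl fun i _ => ?_
  linear_combination -(edgeWeight m (i + 1) * u (i + 1) ^ 2) * hε

end Coords

theorem gegenbauerMean_one_add_mul_sq_pos (n : ℕ) (hn : 2 ≤ n) (ε : ℝ) (hε : ε ^ 2 = 1)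
    (p : ℝ[X]) (hp : p ≠ 0) : 0 < gegenbauerMean n hn ((1 + C ε * X) * p ^ 2) := by
  obtain ⟨m, rfl⟩ := Nat.exists_eq_add_of_le' hn
  obtain ⟨u, hu, e⟩ := exists_gegenbauer_coords m (p.natDegree + 1) p
    (by rw [degree_eq_natDegree hp]; exact_mod_cast Nat.lt_succ_self _)
  set k := p.natDegree + 1
  rw [gegenbauerMean_one_add_mul_sq_of_coords hn hu e ε hε]
  by_contra! hle
  have hnn : ∀ i ∈ Finset.range k, 0 ≤ edgeWeight m (i + 1) * (u i + ε * u (i + 1)) ^ 2 :=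
    fun i _ => mul_nonneg (edgeWeight_nonneg m _) (sq_nonneg _)
  have hz := (Finset.sum_eq_zero_iff_of_nonneg hnn).mp (le_antisymm hle (Finset.sum_nonneg hnn))
  -- Every square vanishes, so `u i = -ε u (i + 1)`; descending from `u k = 0` kills all
  -- coordinates.
  have hu0 : ∀ j i, i + j = k → u i = 0 := by
    intro j
    induction j with
    | zero => intro i hi; exact hu i (by omega)
    | succ j ih =>
      intro i hi
      have h := hz i (Finset.mem_range.mpr (by omega))
      rw [ih (i + 1) (by omega), mul_zero, add_zero, mul_eq_zero] at h
      exact pow_eq_zero_iff two_ne_zero |>.mp (h.resolve_left (edgeWeight_succ_pos m i).ne')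
  apply hp
  rw [e]
  refine Finset.sum_eq_zero fun i hi => ?_
  rw [Finset.mem_range] at hi
  rw [hu0 (k - i) i (by omega), zero_mul, zero_smul]

theorem gegenbauerMean_one_add_X_mul_sq_pos (n : ℕ) (hn : 2 ≤ n) (p : ℝ[X]) (hp : p ≠ 0) :
    0 < gegenbauerMean n hn ((1 + X) * p ^ 2) := by
  simpa using gegenbauerMean_one_add_mul_sq_pos n hn 1 (by norm_num) p hp

theorem gegenbauerMean_one_sub_X_mul_sq_pos (n : ℕ) (hn : 2 ≤ n) (p : ℝ[X]) (hp : p ≠ 0) :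
    0 < gegenbauerMean n hn ((1 - X) * p ^ 2) := by
  simpa [sub_eq_add_neg] using gegenbauerMean_one_add_mul_sq_pos n hn (-1) (by norm_num) p hp

theorem gegenbauerMean_sq_pos (n : ℕ) (hn : 2 ≤ n) (p : ℝ[X]) (hp : p ≠ 0) :
    0 < gegenbauerMean n hn (p ^ 2) :=
  map_sq_pos_of_one_sub_of_one_add (k := p.natDegree + 1)
    (fun p hp _ => gegenbauerMean_one_sub_X_mul_sq_pos n hn p hp)
    (fun p hp _ => gegenbauerMean_one_add_X_mul_sq_pos n hn p hp) p hp
    (by rw [degree_eq_natDegree hp]; exact_mod_cast Nat.lt_succ_self _)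

/-- Gauss quadrature for the mean itself replaces a sum of squares: its nodes lie in `(-1, 1)`,
where `1 - X²` is positive. With `deg p + 2` nodes the formula is exact here, and `p` cannot vanish
at all of them. -/
theorem gegenbauerMean_one_sub_X_sq_mul_sq_pos (n : ℕ) (hn : 2 ≤ n) (p : ℝ[X]) (hp : p ≠ 0) :
    0 < gegenbauerMean n hn ((1 - X ^ 2) * p ^ 2) := by
  set K := p.natDegree + 2
  obtain ⟨α, w, hα, hmem, hw, hf⟩ := exists_gauss_quadrature (gegenbauerMean n hn) K
    (fun p hp _ => gegenbauerMean_one_sub_X_mul_sq_pos n hn p hp)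
    (fun p hp _ => gegenbauerMean_one_add_X_mul_sq_pos n hn p hp)
  have hdeg : ((1 - X ^ 2) * p ^ 2).natDegree ≤ 2 + 2 * p.natDegree :=
    natDegree_mul_le_of_le (by compute_degree) natDegree_pow_le
  rw [hf _ (degree_le_natDegree.trans_lt (by exact_mod_cast (by omega)))]
  have hx : ∀ i, 0 < 1 - α i ^ 2 := fun i => by
    have := (hmem i).1; have := (hmem i).2; nlinarith
  have hnn : ∀ i ∈ Finset.univ, 0 ≤ w i * ((1 - X ^ 2) * p ^ 2).eval (α i) := fun i _ => by
    simp only [eval_mul, eval_sub, eval_one, eval_pow, eval_X]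
    exact mul_nonneg (hw i).le (mul_nonneg (hx i).le (sq_nonneg _))
  refine (Finset.sum_nonneg hnn).lt_of_ne' fun h0 => hp ?_
  have hz := (Finset.sum_eq_zero_iff_of_nonneg hnn).mp h0
  apply eq_zero_of_natDegree_lt_card_of_eval_eq_zero p hα.injective
  · intro i
    have h := hz i (Finset.mem_univ i)
    simp only [eval_mul, eval_sub, eval_one, eval_pow, eval_X] at h
    have h1 := (mul_eq_zero.mp h).resolve_left (hw i).ne'
    exact pow_eq_zero_iff two_ne_zero |>.mp ((mul_eq_zero.mp h1).resolve_left (hx i).ne')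
  · rw [Fintype.card_fin]; omega

/-- Extremal property of the value at `1` for the weight `1 + t`. -/
theorem eval_one_sq_le_mul_mean_one_add_X (m k : ℕ) (hn : 2 ≤ m + 2) (p : ℝ[X])
    (hp : p.degree < k) :
    p.eval 1 ^ 2 ≤ (m + k).choose (m + 1) * gegenbauerMean (m + 2) hn ((1 + X) * p ^ 2) := by
  obtain ⟨u, hu, e⟩ := exists_gegenbauer_coords m k p hp
  have h := gegenbauerMean_one_add_mul_sq_of_coords hn hu e 1 (by norm_num)
  simp only [map_one, one_mul] at h
  have h1 : p.eval 1 = ∑ i ∈ Finset.range k, edgeWeight m (i + 1) * (u i + u (i + 1)) := by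
    rw [eval_one_of_coords e]
    simp only [harmonicDim, mul_add, Finset.sum_add_distrib]
    rw [sum_range_shift (fun i => u i * edgeWeight m i) k (by simp [edgeWeight])
      (by simp [hu k le_rfl]), add_comm]
    congr 1 <;> exact Finset.sum_congr rfl fun i _ => mul_comm _ _
  rw [h, h1, ← sum_edgeWeight]
  -- Cauchy-Schwarz with the edge weights, whose total is the binomial coefficient.
  apply Finset.sum_sq_le_sum_mul_sum_of_sq_le_mul
  · exact fun i _ => edgeWeight_nonneg m _
  · exact fun i _ => mul_nonneg (edgeWeight_nonneg m _) (sq_nonneg _)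
  · exact fun i _ => le_of_eq (by ring)

/-- Extremal property of the value at `1`. -/
theorem eval_one_sq_le_mul_mean (m k : ℕ) (hn : 2 ≤ m + 2) (p : ℝ[X])
    (hp : p.degree < (k + 1 : ℕ)) :
    p.eval 1 ^ 2 ≤ ((m + k).choose (m + 1) + (m + k + 1).choose (m + 1)) *
      gegenbauerMean (m + 2) hn (p ^ 2) := by
  obtain ⟨u, hu, e⟩ := exists_gegenbauer_coords m (k + 1) p hp
  have hs : ((m + k).choose (m + 1) + (m + k + 1).choose (m + 1) : ℝ) =
      ∑ i ∈ Finset.range (k + 1), harmonicDim m i := by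
    simp only [harmonicDim, Finset.sum_add_distrib]
    rw [sum_edgeWeight, Finset.sum_range_succ', sum_edgeWeight, edgeWeight, add_zero, add_assoc]
  rw [gegenbauerMean_sq_of_coords hn hu e, eval_one_of_coords e, hs]
  apply Finset.sum_sq_le_sum_mul_sum_of_sq_le_mul
  · exact fun i _ => (harmonicDim_pos m i).le
  · exact fun i _ => mul_nonneg (harmonicDim_pos m i).le (sq_nonneg _)
  · exact fun i _ => le_of_eq (by ring)

/-! ### The Levenshtein functional and its quadratures -/

/-- The functional `f ↦ f_0 - f(1) / N`. -/
noncomputable def levenshteinFunctional (n : ℕ) (hn : 2 ≤ n) (N : ℕ) : ℝ[X] →ₗ[ℝ] ℝ :=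
  gegenbauerMean n hn - (N : ℝ)⁻¹ • leval 1

theorem levenshteinFunctional_apply (n : ℕ) (hn : 2 ≤ n) (N : ℕ) (f : ℝ[X]) :
    levenshteinFunctional n hn N f = gegenbauerCoeff n hn f 0 - f.eval 1 / N := by
  simp only [levenshteinFunctional, LinearMap.sub_apply, LinearMap.smul_apply, leval_apply,
    smul_eq_mul, inv_mul_eq_div]
  rfl

theorem levenshteinFunctional_eq_mean_sub (n : ℕ) (hn : 2 ≤ n) (N : ℕ) (f : ℝ[X]) :
    levenshteinFunctional n hn N f = gegenbauerMean n hn f - f.eval 1 / N :=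
  levenshteinFunctional_apply n hn N f

theorem levenshteinFunctional_one_sub_X_mul_sq_pos (n : ℕ) (hn : 2 ≤ n) (N : ℕ) (p : ℝ[X])
    (hp : p ≠ 0) : 0 < levenshteinFunctional n hn N ((1 - X) * p ^ 2) := by
  rw [levenshteinFunctional_eq_mean_sub]
  simpa using gegenbauerMean_one_sub_X_mul_sq_pos n hn p hp

/-- The subtracted term is `2 p(1)² / N`, and the extremal bound for `p(1)²` makes it smaller than
the mean precisely under this threshold, `D(n, 2k-1)`. -/
theorem levenshteinFunctional_one_add_X_mul_sq_pos (n : ℕ) (hn : 2 ≤ n) (N k : ℕ)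
    (hN : 2 * (n + k - 2).choose (n - 1) < N) (p : ℝ[X]) (hp : p ≠ 0) (hpk : p.degree < k) :
    0 < levenshteinFunctional n hn N ((1 + X) * p ^ 2) := by
  obtain ⟨m, rfl⟩ := Nat.exists_eq_add_of_le' hn
  have hpos := gegenbauerMean_one_add_X_mul_sq_pos (m + 2) hn p hp
  have hle := eval_one_sq_le_mul_mean_one_add_X m k hn p hpk
  rw [show m + 2 + k - 2 = m + k by omega, show m + 2 - 1 = m + 1 by omega] at hN
  have hN' : (2 * (m + k).choose (m + 1) : ℝ) < N := by exact_mod_cast hN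
  have hN0 : (0 : ℝ) < N := by
    have : (0 : ℝ) ≤ 2 * (m + k).choose (m + 1) := by positivity
    linarith
  rw [levenshteinFunctional_eq_mean_sub, sub_pos, div_lt_iff₀ hN0]
  simp only [eval_mul, eval_add, eval_one, eval_X, eval_pow]
  nlinarith

theorem levenshteinFunctional_sq_pos (n : ℕ) (hn : 2 ≤ n) (N k : ℕ)
    (hN : (n + k - 1).choose (n - 1) + (n + k - 2).choose (n - 1) < N) (p : ℝ[X]) (hp : p ≠ 0)
    (hpk : p.degree < (k + 1 : ℕ)) : 0 < levenshteinFunctional n hn N (p ^ 2) := by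
  obtain ⟨m, rfl⟩ := Nat.exists_eq_add_of_le' hn
  have hpos := gegenbauerMean_sq_pos (m + 2) hn p hp
  have hle := eval_one_sq_le_mul_mean m k hn p hpk
  rw [show m + 2 + k - 2 = m + k by omega, show m + 2 + k - 1 = m + k + 1 by omega,
    show m + 2 - 1 = m + 1 by omega] at hN
  have hN' : ((m + k).choose (m + 1) + (m + k + 1).choose (m + 1) : ℝ) < N := by
    rw [add_comm]; exact_mod_cast hN
  have hN0 : (0 : ℝ) < N := by
    have : (0 : ℝ) ≤ (m + k).choose (m + 1) + (m + k + 1).choose (m + 1) := by positivity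
    linarith
  rw [levenshteinFunctional_eq_mean_sub, sub_pos, div_lt_iff₀ hN0, eval_pow]
  nlinarith

theorem natDegree_le_of_degree_lt {f : ℝ[X]} {d e : ℕ} (h : f.degree < (d : ℕ)) (hde : d ≤ e + 1) :
    f.natDegree ≤ e := by
  rcases eq_or_ne f 0 with rfl | hf
  · simp
  · rw [degree_eq_natDegree hf] at h
    norm_cast at h
    omega

theorem degree_lt_of_natDegree_le {f : ℝ[X]} {d e : ℕ} (h : f.natDegree ≤ e) (hde : e < d) :
    f.degree < (d : ℕ) :=
  degree_le_natDegree.trans_lt (by exact_mod_cast h.trans_lt hde)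

theorem exists_isOddQuadrature (n : ℕ) (hn : 2 ≤ n) (N k : ℕ) (hk : 1 ≤ k)
    (hN : dgsBound n (2 * k - 1) < N) :
    ∃ α ρ : Fin k → ℝ, IsOddQuadrature n hn N k α ρ ∧
      ∀ α' ρ' : Fin k → ℝ, IsOddQuadrature n hn N k α' ρ' → α' = α ∧ ρ' = ρ := by
  rw [dgsBound, if_pos ⟨k - 1, by omega⟩, show (2 * k - 1 + 1) / 2 = k by omega] at hN
  have h1 := fun (p : ℝ[X]) (hp : p ≠ 0) (_ : p.degree < (k : ℕ)) =>
    levenshteinFunctional_one_sub_X_mul_sq_pos n hn N p hp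
  have h2 := levenshteinFunctional_one_add_X_mul_sq_pos n hn N k hN
  obtain ⟨α, ρ, hα, hmem, hρ, hf⟩ := exists_gauss_quadrature _ k h1 h2
  refine ⟨α, ρ, ⟨hα, fun i => (hmem i).1, fun i => (hmem i).2, hρ, fun f hfd => ?_⟩,
    fun α' ρ' h' => ?_⟩
  · have := hf f (degree_lt_of_natDegree_le hfd (by omega))
    rw [levenshteinFunctional_apply] at this
    linarith
  · refine gauss_quadrature_unique (map_sq_pos_of_one_sub_of_one_add h1 h2) hα h'.strictMono hf
      fun f hfd => ?_
    rw [levenshteinFunctional_apply, h'.formula f (natDegree_le_of_degree_lt hfd (by omega))]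
    ring

/-- Writing `f = f(-1) + (1 + X)g` reduces the formula to Gauss quadrature for `g ↦ L ((1 + X)g)`,
whose weights are those of `L` multiplied by `1 + β_i`. -/
theorem exists_isEvenQuadrature (n : ℕ) (hn : 2 ≤ n) (N k : ℕ) (hk : 1 ≤ k)
    (hN : dgsBound n (2 * k) < N) :
    ∃ β γ : Fin (k + 1) → ℝ, IsEvenQuadrature n hn N k β γ ∧
      ∀ β' γ' : Fin (k + 1) → ℝ, IsEvenQuadrature n hn N k β' γ' → β' = β ∧ γ' = γ := by
  rw [dgsBound, if_neg (by simp), show 2 * k / 2 = k by omega] at hN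
  set L := levenshteinFunctional n hn N
  set M : ℝ[X] →ₗ[ℝ] ℝ := L ∘ₗ LinearMap.mulLeft ℝ (1 + X)
  have hMdef : ∀ g, M g = L ((1 + X) * g) := fun g => rfl
  have h1X : (1 + X : ℝ[X]).natDegree = 1 := by rw [add_comm]; exact natDegree_X_add_C (1 : ℝ)
  have hX0 : (1 + X : ℝ[X]) ≠ 0 := by intro h; rw [h, natDegree_zero] at h1X; omega
  have h1 : ∀ p : ℝ[X], p ≠ 0 → p.degree < (k : ℕ) → 0 < M ((1 - X) * p ^ 2) := by
    intro p hp _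
    rw [hMdef, levenshteinFunctional_eq_mean_sub,
      show (1 + X) * ((1 - X) * p ^ 2) = (1 - X ^ 2) * p ^ 2 by ring]
    simpa using gegenbauerMean_one_sub_X_sq_mul_sq_pos n hn p hp
  have h2 : ∀ p : ℝ[X], p ≠ 0 → p.degree < (k : ℕ) → 0 < M ((1 + X) * p ^ 2) := by
    intro p hp hpk
    rw [hMdef, show (1 + X) * ((1 + X) * p ^ 2) = ((1 + X) * p) ^ 2 by ring]
    refine levenshteinFunctional_sq_pos n hn N k hN _ (mul_ne_zero hX0 hp) ?_
    rw [degree_eq_natDegree hp] at hpk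
    norm_cast at hpk
    exact degree_lt_of_natDegree_le (natDegree_mul hX0 hp).le (by omega)
  have hsplit : ∀ f : ℝ[X], ∃ g : ℝ[X], f = C (f.eval (-1)) + (1 + X) * g ∧
      g.natDegree = f.natDegree - 1 := by
    intro f
    refine ⟨f /ₘ (X - C (-1)), ?_, by
      rw [natDegree_divByMonic _ (monic_X_sub_C _), natDegree_X_sub_C]⟩
    have := modByMonic_add_div f (X - C (-1))
    rw [modByMonic_X_sub_C_eq_C_eval] at this
    conv_lhs => rw [← this]
    simp [add_comm]
  have hform : ∀ (β γ : Fin (k + 1) → ℝ), β 0 = -1 → (∀ i : Fin k, -1 < β i.succ) →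
      L 1 = ∑ i, γ i →
      (∀ g : ℝ[X], g.degree < (2 * k : ℕ) →
        M g = ∑ i : Fin k, (γ i.succ * (1 + β i.succ)) * g.eval (β i.succ)) →
      ∀ f : ℝ[X], f.natDegree ≤ 2 * k → L f = ∑ i, γ i * f.eval (β i) := by
    intro β γ hβ0 hβ hL hg f hf
    obtain ⟨g, e, hgd⟩ := hsplit f
    have hgM := hg g (degree_lt_of_natDegree_le hgd.le (by omega))
    have hLf : L f = f.eval (-1) * L 1 + M g := by
      conv_lhs => rw [e, map_add, ← hMdef, ← mul_one (C _), ← smul_eq_C_mul, map_smul, smul_eq_mul]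
    rw [hLf, hL, hgM, Finset.mul_sum, Fin.sum_univ_succ, Fin.sum_univ_succ, hβ0, add_assoc,
      ← Finset.sum_add_distrib]
    congr 1
    · ring
    · refine Finset.sum_congr rfl fun i _ => ?_
      have : f.eval (β i.succ) = f.eval (-1) + (1 + β i.succ) * g.eval (β i.succ) := by
        conv_lhs => rw [e]
        simp
      rw [this]
      ring
  obtain ⟨α, w, hα, hmem, hw, hf⟩ := exists_gauss_quadrature M k h1 h2
  have hpos : ∀ i, 0 < 1 + α i := fun i => by linarith [(hmem i).1]
  set β : Fin (k + 1) → ℝ := Fin.cons (-1) α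
  -- The weight at `-1` is forced by exactness on constants.
  set γ : Fin (k + 1) → ℝ := Fin.cons (L 1 - ∑ i, w i / (1 + α i)) fun i => w i / (1 + α i)
  have hβs : ∀ i : Fin k, β i.succ = α i := fun i => Fin.cons_succ _ _ _
  have hγs : ∀ i : Fin k, γ i.succ = w i / (1 + α i) := fun i => Fin.cons_succ _ _ _
  have hβ0 : β 0 = -1 := Fin.cons_zero _ _
  have hγ0 : γ 0 = L 1 - ∑ i, w i / (1 + α i) := Fin.cons_zero _ _
  have hall : ∀ f : ℝ[X], f.natDegree ≤ 2 * k → L f = ∑ i, γ i * f.eval (β i) := by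
    refine hform β γ hβ0 (fun i => by rw [hβs]; exact (hmem i).1) ?_ fun g hg => ?_
    · rw [Fin.sum_univ_succ, hγ0]
      simp only [hγs, sub_add_cancel]
    · rw [hf g hg]
      refine Finset.sum_congr rfl fun i _ => ?_
      rw [hβs, hγs, div_mul_cancel₀ _ (hpos i).ne']
  refine ⟨β, γ, ⟨?_, hβ0, ?_, ?_, fun f hfd => ?_⟩, fun β' γ' h' => ?_⟩
  · rw [Fin.strictMono_iff_lt_succ]
    intro i
    rcases Fin.eq_zero_or_eq_succ i.castSucc with h | ⟨j, h⟩
    · rw [h, hβ0, hβs]; exact (hmem i).1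
    · rw [h, hβs, hβs]
      apply hα
      rw [Fin.lt_def]
      have := congrArg Fin.val h
      simp at this
      omega
  · intro i
    refine Fin.cases ?_ (fun i => ?_) i
    · rw [hβ0]; norm_num
    · rw [hβs]; exact (hmem i).2
  · intro i
    refine Fin.cases ?_ (fun i => ?_) i
    -- For the weight at `-1` the test polynomial is the square of the nodal polynomial of the other
    -- nodes; its degree `2k` is still within exactness.
    · have hnd : (Lagrange.nodal Finset.univ α).natDegree = k := by simp
      have hn0 : Lagrange.nodal Finset.univ α ≠ 0 := (Lagrange.nodal_monic).ne_zero
      have hp := levenshteinFunctional_sq_pos n hn N k hN _ hn0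
        (degree_lt_of_natDegree_le hnd.le (by omega))
      have hall' := hall (Lagrange.nodal Finset.univ α ^ 2) (by rw [natDegree_pow, hnd])
      rw [Fin.sum_univ_succ, Finset.sum_eq_zero, add_zero] at hall'
      · rw [hall', eval_pow] at hp
        exact pos_of_mul_pos_left hp (sq_nonneg _)
      · intro j _
        rw [hβs, eval_pow, Lagrange.eval_nodal_at_node (Finset.mem_univ j)]
        simp
    · rw [hγs]; exact div_pos (hw i) (hpos i)
  · have := hall f hfd
    rw [levenshteinFunctional_apply] at this
    linarith
  · have hL' : ∀ f : ℝ[X], f.natDegree ≤ 2 * k → L f = ∑ i, γ' i * f.eval (β' i) := by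
      intro f hfd
      rw [levenshteinFunctional_apply, h'.formula f hfd]
      ring
    have hM' : ∀ g : ℝ[X], g.degree < (2 * k : ℕ) →
        M g = ∑ i : Fin k, (γ' i.succ * (1 + β' i.succ)) * g.eval (β' i.succ) := by
      intro g hg
      have hd : ((1 + X) * g).natDegree ≤ 2 * k := by
        rcases eq_or_ne g 0 with rfl | hg0
        · simp
        rw [natDegree_mul hX0 hg0, h1X]
        rw [degree_eq_natDegree hg0] at hg
        norm_cast at hg
        omega
      rw [hMdef, hL' _ hd, Fin.sum_univ_succ, h'.zero_eq]
      simp [mul_assoc]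
    obtain ⟨ha, hv⟩ := gauss_quadrature_unique (map_sq_pos_of_one_sub_of_one_add h1 h2) hα
      (fun i j hij => h'.strictMono (Fin.succ_lt_succ_iff.mpr hij)) hf hM'
    have ha' : ∀ i : Fin k, β' i.succ = α i := congrFun ha
    have hv' : ∀ i : Fin k, γ' i.succ = w i / (1 + α i) := fun i => by
      rw [eq_div_iff (hpos i).ne', ← ha' i]; exact congrFun hv i
    have hone := hL' 1 (by simp)
    simp only [eval_one, mul_one] at hone
    rw [Fin.sum_univ_succ] at hone
    constructor
    · funext i
      refine Fin.cases ?_ (fun i => ?_) i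
      · rw [hβ0, h'.zero_eq]
      · rw [hβs, ha']
    · funext i
      refine Fin.cases ?_ (fun i => ?_) i
      · rw [hγ0, hone]
        simp only [hv', add_sub_cancel_right]
      · rw [hγs, hv']

/-! ### Hermite interpolation of absolutely monotone functions -/

/-- Rolle's theorem for finitely many zeros. -/
theorem exists_zeros_of_derivative {g g' : ℝ → ℝ} {a b : ℝ} (hc : ContinuousOn g (Set.Icc a b))
    (hd : ∀ x ∈ Set.Ioo a b, HasDerivAt g (g' x) x) {m : ℕ} {Z : Finset ℝ} (hZ : Z.card = m + 1)
    (hZab : ∀ z ∈ Z, z ∈ Set.Icc a b) (hZ0 : ∀ z ∈ Z, g z = 0) :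
    ∃ Y : Finset ℝ, Y.card = m ∧ Disjoint Y Z ∧ (∀ y ∈ Y, y ∈ Set.Ioo a b) ∧ ∀ y ∈ Y, g' y = 0 := by
  set z := Z.orderEmbOfFin hZ
  have hz : ∀ i, z i ∈ Z := Finset.orderEmbOfFin_mem Z hZ
  have hex : ∀ i : Fin m, ∃ y ∈ Set.Ioo (z i.castSucc) (z i.succ), g' y = 0 := by
    intro i
    have h1 := (hZab _ (hz i.castSucc)).1
    have h2 := (hZab _ (hz i.succ)).2
    refine exists_hasDerivAt_eq_zero (f := g) (z.strictMono (Fin.castSucc_lt_succ))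
      (hc.mono (Set.Icc_subset_Icc h1 h2)) (by rw [hZ0 _ (hz _), hZ0 _ (hz _)]) fun x hx => ?_
    exact hd x ⟨h1.trans_lt hx.1, hx.2.trans_le h2⟩
  choose y hy hy0 using hex
  have hmono : StrictMono y := by
    intro i j hij
    have : z i.succ ≤ z j.castSucc := z.monotone (by rw [Fin.le_def]; simpa using hij)
    exact ((hy i).2.trans_le this).trans (hy j).1
  refine ⟨Finset.univ.image y, ?_, ?_, ?_, ?_⟩
  · rw [Finset.card_image_of_injective _ hmono.injective, Finset.card_univ, Fintype.card_fin]
  · rw [Finset.disjoint_left]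
    intro w hw hwZ
    obtain ⟨i, -, rfl⟩ := Finset.mem_image.mp hw
    obtain ⟨j, hj⟩ : y i ∈ Set.range z := by rw [Finset.range_orderEmbOfFin]; exact hwZ
    rcases le_or_gt j i.castSucc with h | h
    · exact absurd (z.monotone h) (by rw [hj]; exact not_le.mpr (hy i).1)
    · exact absurd (z.monotone (Fin.castSucc_lt_iff_succ_le.mp h))
        (by rw [hj]; exact not_le.mpr (hy i).2)
  · intro w hw
    obtain ⟨i, -, rfl⟩ := Finset.mem_image.mp hw
    exact ⟨(hZab _ (hz _)).1.trans_lt (hy i).1, (hy i).2.trans_le (hZab _ (hz _)).2⟩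
  · intro w hw
    obtain ⟨i, -, rfl⟩ := Finset.mem_image.mp hw
    exact hy0 i

theorem exists_zero_of_iterated_derivative {g : ℕ → ℝ → ℝ} {a b : ℝ}
    (hd : ∀ j, ∀ x ∈ Set.Ioo a b, HasDerivAt (g j) (g (j + 1) x) x) (m j : ℕ) (Z : Finset ℝ)
    (hZ : Z.card = m + 1) (hZab : ∀ z ∈ Z, z ∈ Set.Ioo a b) (hZ0 : ∀ z ∈ Z, g j z = 0) :
    ∃ ξ ∈ Set.Ioo a b, g (j + m) ξ = 0 := by
  induction m generalizing j Z with
  | zero =>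
    obtain ⟨z, hz⟩ := Finset.card_pos.mp (by omega : 0 < Z.card)
    exact ⟨z, hZab z hz, hZ0 z hz⟩
  | succ m ih =>
    have hne : Z.Nonempty := Finset.card_pos.mp (by omega)
    have hsub : Set.Icc (Z.min' hne) (Z.max' hne) ⊆ Set.Ioo a b :=
      Set.Icc_subset_Ioo (hZab _ (Z.min'_mem hne)).1 (hZab _ (Z.max'_mem hne)).2
    obtain ⟨Y, hY, -, hYab, hY0⟩ := exists_zeros_of_derivative
      (fun x hx => (hd j x (hsub hx)).continuousAt.continuousWithinAt)
      (fun x hx => hd j x (hsub (Set.Ioo_subset_Icc_self hx))) hZ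
      (fun z hz => ⟨Z.min'_le z hz, Z.le_max' z hz⟩) hZ0
    obtain ⟨ξ, hξ, h⟩ := ih (j + 1) Y hY
      (fun y hy => hsub (Set.Ioo_subset_Icc_self (hYab y hy))) hY0
    exact ⟨ξ, hξ, by rwa [show j + (m + 1) = j + 1 + m by omega]⟩

/-- The successive derivatives of an absolutely monotone function on an interval. -/
theorem AbsolutelyMonotoneOn.exists_derivatives {h : ℝ → ℝ} {a b : ℝ}
    (hh : AbsolutelyMonotoneOn h (Set.Icc a b)) :
    ∃ H : ℕ → ℝ → ℝ, (∀ x ∈ Set.Icc a b, H 0 x = h x) ∧ ContinuousOn h (Set.Icc a b) ∧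
      (∀ j, ∀ x ∈ Set.Ioo a b, HasDerivAt (H j) (H (j + 1) x) x) ∧
      ∀ j, ∀ x ∈ Set.Icc a b, 0 ≤ H j x := by
  have hcont := hh.contDiffOn.continuousOn
  obtain ⟨p, hp, hnn⟩ := hh
  -- The `j`-th Taylor term on the vector of ones is the `j`-th derivative. Two-sided derivatives
  -- are available only in the interior; at the endpoints continuity of `h` suffices.
  refine ⟨fun j x => p x j fun _ => 1, fun x hx => ?_, hcont, fun j x hx => ?_,
    fun j x hx => hnn j hx⟩
  · rw [← hp.zero_eq x hx]
    show p x 0 _ = p x 0 _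
    congr 1
    exact Subsingleton.elim _ _
  · have h1 := (hp.fderivWithin j (by exact_mod_cast WithTop.coe_lt_top _) x
      (Set.Ioo_subset_Icc_self hx)).hasFDerivAt (Icc_mem_nhds hx.1 hx.2)
    have h2 := ((ContinuousMultilinearMap.apply ℝ (fun _ : Fin j => ℝ) ℝ
      fun _ => (1 : ℝ)).hasFDerivAt.comp x h1).hasDerivAt
    have e : (fun _ : Fin (j + 1) => (1 : ℝ)) = Fin.cons 1 fun _ => 1 := by
      funext i
      exact Fin.cases rfl (fun i => rfl) i
    show HasDerivAt (fun y => p y j fun _ => 1) (p x (j + 1) fun _ => 1) x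
    rw [e]
    exact h2

section Hermite

variable {ι : Type*} [Fintype ι] {v : ι → ℝ}

/-- `D` indexes the doubled nodes. Counted with multiplicity, a nonzero `F` would have at least
`card ι + D.card` roots, more than its degree. -/
theorem eq_zero_of_hermite_data_eq_zero (hv : Function.Injective v) (D : Finset ι)
    (F : ℝ[X]) (hF : F.degree < (Fintype.card ι + D.card : ℕ)) (h0 : ∀ i, F.eval (v i) = 0)
    (h1 : ∀ i ∈ D, F.derivative.eval (v i) = 0) : F = 0 := by
  classical
  by_contra hne
  have hle : (Finset.univ.image v).val + (D.image v).val ≤ F.roots := by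
    rw [Multiset.le_iff_count]
    intro x
    rw [Multiset.count_add, count_roots, Multiset.count_eq_of_nodup (Finset.nodup _),
      Multiset.count_eq_of_nodup (Finset.nodup _)]
    by_cases hxD : x ∈ (D.image v).val
    · obtain ⟨i, hi, rfl⟩ := Finset.mem_image.mp hxD
      have := (one_lt_rootMultiplicity_iff_isRoot hne).mpr ⟨h0 i, h1 i hi⟩
      split_ifs <;> omega
    · rw [if_neg hxD]
      split_ifs with hx
      · obtain ⟨i, -, rfl⟩ := Finset.mem_image.mp hx
        have := (rootMultiplicity_pos hne).mpr (h0 i)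
        omega
      · omega
  have hc := (Multiset.card_le_card hle).trans (card_roots' F)
  rw [Multiset.card_add, Finset.card_val, Finset.card_val,
    Finset.card_image_of_injective _ hv, Finset.card_image_of_injective _ hv,
    Finset.card_univ] at hc
  rw [degree_eq_natDegree hne] at hF
  norm_cast at hF
  omega

/-- Existence of the Hermite interpolant. -/
theorem exists_hermite_interpolant (hv : Function.Injective v) (D : Finset ι) (a b : ι → ℝ) :
    ∃ F : ℝ[X], F.degree < (Fintype.card ι + D.card : ℕ) ∧ (∀ i, F.eval (v i) = a i) ∧
      ∀ i ∈ D, F.derivative.eval (v i) = b i := by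
  set d := Fintype.card ι + D.card
  -- Source and target have equal dimension, so uniqueness of the interpolant yields existence.
  let T : degreeLT ℝ d →ₗ[ℝ] (ι → ℝ) × (D → ℝ) :=
    (LinearMap.prod (LinearMap.pi fun i => leval (v i))
      (LinearMap.pi fun i : D => leval (v i) ∘ₗ derivative)) ∘ₗ (degreeLT ℝ d).subtype
  have hinj : Function.Injective T := by
    rw [← LinearMap.ker_eq_bot, LinearMap.ker_eq_bot']
    intro F hF
    refine Subtype.ext (eq_zero_of_hermite_data_eq_zero hv D F.1 (mem_degreeLT.mp F.2)
      (fun i => congrFun (congrArg Prod.fst hF) i)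
      (fun i hi => congrFun (congrArg Prod.snd hF) ⟨i, hi⟩))
  have : FiniteDimensional ℝ (degreeLT ℝ d) := Module.Finite.equiv (degreeLTEquiv ℝ d).symm
  have hrank : Module.finrank ℝ (degreeLT ℝ d) = Module.finrank ℝ ((ι → ℝ) × (D → ℝ)) := by
    rw [(degreeLTEquiv ℝ d).finrank_eq]
    simp [d]
  obtain ⟨F, hF⟩ := (LinearMap.injective_iff_surjective_of_finrank_eq_finrank hrank).mp hinj
    (a, fun i => b i)
  exact ⟨F.1, mem_degreeLT.mp F.2, fun i => congrFun (congrArg Prod.fst hF) i,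
    fun i hi => congrFun (congrArg Prod.snd hF) ⟨i, hi⟩⟩

theorem iterate_derivative_eval_of_natDegree_le {R : ℝ[X]} {d : ℕ} (hR : R.natDegree ≤ d) (x : ℝ) :
    (derivative^[d] R).eval x = d.factorial * R.coeff d := by
  have h : (derivative^[d] R).natDegree ≤ 0 := by
    have := natDegree_iterate_derivative R d
    omega
  rw [eq_C_of_natDegree_le_zero h, eval_C, coeff_iterate_derivative, zero_add,
    Nat.descFactorial_self, nsmul_eq_mul]

/-- A Hermite interpolant of an absolutely monotone function lies below it wherever the nodal
polynomial is nonnegative. -/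
theorem AbsolutelyMonotoneOn.hermite_le [Nonempty ι] {h : ℝ → ℝ} {a b : ℝ}
    (hh : AbsolutelyMonotoneOn h (Set.Icc a b)) (hv : Function.Injective v) (D : Finset ι)
    (hvab : ∀ i, v i ∈ Set.Icc a b) (hD : ∀ i ∈ D, v i ∈ Set.Ioo a b) {F : ℝ[X]}
    (hF : F.degree < (Fintype.card ι + D.card : ℕ)) (h0 : ∀ i, F.eval (v i) = h (v i))
    (h1 : ∀ i ∈ D, F.derivative.eval (v i) = deriv h (v i)) {t : ℝ} (ht : t ∈ Set.Icc a b)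
    (hpos : 0 ≤ (∏ i, (t - v i)) * ∏ i ∈ D, (t - v i)) : F.eval t ≤ h t := by
  classical
  by_cases htv : ∃ i, t = v i
  · obtain ⟨i, rfl⟩ := htv
    exact (h0 i).le
  push Not at htv
  obtain ⟨H, hH0, hcont, hHd, hHnn⟩ := hh.exists_derivatives
  set d := Fintype.card ι + D.card
  set W : ℝ[X] := Lagrange.nodal Finset.univ v * Lagrange.nodal D v with hW
  have hWm : W.Monic := Lagrange.nodal_monic.mul Lagrange.nodal_monic
  have hWd : W.natDegree = d := by
    rw [hW, Lagrange.nodal_monic.natDegree_mul Lagrange.nodal_monic]; simp [d]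
  have hWt : W.eval t = (∏ i, (t - v i)) * ∏ i ∈ D, (t - v i) := by
    rw [hW, eval_mul, Lagrange.eval_nodal, Lagrange.eval_nodal]
  have hWpos : 0 < W.eval t := by
    refine lt_of_le_of_ne (by rwa [hWt]) (Ne.symm ?_)
    rw [hWt]
    exact mul_ne_zero (Finset.prod_ne_zero_iff.mpr fun i _ => sub_ne_zero.mpr (htv i))
      (Finset.prod_ne_zero_iff.mpr fun i _ => sub_ne_zero.mpr (htv i))
  -- With this `c`, `R = F + cW` keeps the Hermite data and also meets `h` at `t`; the sign of `c`
  -- decides the claim.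
  set c := (h t - F.eval t) / W.eval t
  set R : ℝ[X] := F + C c * W with hR
  have hRd : R.natDegree ≤ d := by
    refine natDegree_add_le_of_degree_le (natDegree_le_of_degree_lt hF (by omega)) ?_
    exact (natDegree_C_mul_le _ _).trans hWd.le
  have hRc : R.coeff d = c := by
    rw [hR, coeff_add, coeff_C_mul, coeff_eq_zero_of_degree_lt hF, ← hWd,
      hWm.coeff_natDegree, zero_add, mul_one]
  have hRv : ∀ i, R.eval (v i) = h (v i) := fun i => by
    simp [hR, hW, h0 i, Lagrange.eval_nodal_at_node (Finset.mem_univ i)]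
  have hRt : R.eval t = h t := by
    rw [hR, eval_add, eval_mul, eval_C, div_mul_cancel₀ _ hWpos.ne']
    ring
  have hRD : ∀ i ∈ D, R.derivative.eval (v i) = deriv h (v i) := fun i hi => by
    simp [hR, hW, h1 i hi, Lagrange.eval_nodal_at_node (Finset.mem_univ i),
      Lagrange.eval_nodal_at_node hi]
  set g : ℕ → ℝ → ℝ := fun j x => H j x - (derivative^[j] R).eval x with hg
  have hgd : ∀ j, ∀ x ∈ Set.Ioo a b, HasDerivAt (g j) (g (j + 1) x) x := fun j x hx => by
    simp only [hg, Function.iterate_succ_apply']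
    exact (hHd j x hx).sub (Polynomial.hasDerivAt _ x)
  have hHD : ∀ x ∈ Set.Ioo a b, deriv h x = H 1 x := fun x hx => by
    apply HasDerivAt.deriv
    refine (hHd 0 x hx).congr_of_eventuallyEq ?_
    filter_upwards [Icc_mem_nhds hx.1 hx.2] with y hy using (hH0 y hy).symm
  have hgc : ContinuousOn (g 0) (Set.Icc a b) :=
    (hcont.congr hH0).sub (Polynomial.continuous _).continuousOn
  have htn : t ∉ Finset.univ.image v := by
    simpa using fun i => (htv i).symm
  -- The first Rolle step is separate because a simple node may be an endpoint. Its zeros avoid the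
  -- nodes, so the doubled nodes add `D.card` new zeros of `g 1`, making `d` in all.
  obtain ⟨Y, hY, hYZ, hYab, hY0⟩ := exists_zeros_of_derivative (m := Fintype.card ι) hgc
    (hgd 0) (Z := insert t (Finset.univ.image v))
    (by rw [Finset.card_insert_of_notMem htn, Finset.card_image_of_injective _ hv,
      Finset.card_univ])
    (by
      intro z hz
      rcases Finset.mem_insert.mp hz with rfl | hz
      · exact ht
      · obtain ⟨i, -, rfl⟩ := Finset.mem_image.mp hz
        exact hvab i)
    (by
      intro z hz
      rcases Finset.mem_insert.mp hz with rfl | hz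
      · simp [hg, hH0 z ht, hRt]
      · obtain ⟨i, -, rfl⟩ := Finset.mem_image.mp hz
        simp [hg, hH0 _ (hvab i), hRv i])
  have key : ∃ ξ ∈ Set.Ioo a b, g d ξ = 0 := by
    have hdisj : Disjoint Y (D.image v) := hYZ.mono_right
      ((Finset.image_subset_image (Finset.subset_univ D)).trans (Finset.subset_insert _ _))
    have hd0 : 0 < d := Nat.add_pos_left Fintype.card_pos _
    obtain ⟨ξ, hξ, hξ0⟩ := exists_zero_of_iterated_derivative hgd (d - 1) 1 (Y ∪ D.image v)
      (by
        rw [Finset.card_union_of_disjoint hdisj, hY, Finset.card_image_of_injective _ hv]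
        omega)
      (by
        intro z hz
        rcases Finset.mem_union.mp hz with hz | hz
        · exact hYab z hz
        · obtain ⟨i, hi, rfl⟩ := Finset.mem_image.mp hz
          exact hD i hi)
      (by
        intro z hz
        rcases Finset.mem_union.mp hz with hz | hz
        · exact hY0 z hz
        · obtain ⟨i, hi, rfl⟩ := Finset.mem_image.mp hz
          simp [hg, ← hHD _ (hD i hi), hRD i hi])
    exact ⟨ξ, hξ, by rwa [show 1 + (d - 1) = d by omega] at hξ0⟩
  obtain ⟨ξ, hξ, hξ0⟩ := key
  have hcnn : 0 ≤ c := by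
    -- Only the leading term `cW` of `R` survives `d` differentiations.
    have e : H d ξ = d.factorial * c := by
      have := sub_eq_zero.mp hξ0
      rwa [iterate_derivative_eval_of_natDegree_le hRd, hRc] at this
    have := hHnn d ξ (Set.Ioo_subset_Icc_self hξ)
    rw [e] at this
    exact nonneg_of_mul_nonneg_right this (by positivity)
  have : 0 ≤ h t - F.eval t := by
    rw [← div_mul_cancel₀ (h t - F.eval t) hWpos.ne']
    exact mul_nonneg hcnn hWpos.le
  linarith

end Hermite

/-! ### Optimality of the Hermite interpolant -/

theorem lpBound_eq (n : ℕ) (hn : 2 ≤ n) {N : ℕ} (hN : 0 < N) {ι : Type*} [Fintype ι]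
    {v w : ι → ℝ} {f : ℝ[X]}
    (hf : gegenbauerCoeff n hn f 0 = f.eval 1 / N + ∑ i, w i * f.eval (v i)) :
    lpBound n hn N f = (N : ℝ) ^ 2 * ∑ i, w i * f.eval (v i) := by
  have : (N : ℝ) ≠ 0 := by positivity
  rw [lpBound, hf]
  field_simp
  ring

theorem IsOddQuadrature.exists_optimal_hermite {n : ℕ} {hn : 2 ≤ n} {N k : ℕ} (hN : 0 < N)
    (hk : 1 ≤ k) {α ρ : Fin k → ℝ} (hq : IsOddQuadrature n hn N k α ρ) {I : Set ℝ} {h : ℝ → ℝ}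
    (hI : I ⊆ Set.Ico (-1) 1) (hh : AbsolutelyMonotoneOn h (Set.Icc (-1) 1))
    (hαI : ∀ i, α i ∈ I) :
    ∃ F : ℝ[X], IsOddHermite k α h F ∧ (∀ G : ℝ[X], IsOddHermite k α h G → G = F) ∧
      IsBelowOn I h F ∧
      (∀ f : ℝ[X], f.natDegree ≤ 2 * k - 1 → IsBelowOn I h f →
        lpBound n hn N f ≤ lpBound n hn N F) ∧
      lpBound n hn N F = (N : ℝ) ^ 2 * ∑ i, ρ i * h (α i) := by
  have hv := hq.strictMono.injective
  have hcard : Fintype.card (Fin k) + (Finset.univ : Finset (Fin k)).card = 2 * k := by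
    simp; omega
  have : Nonempty (Fin k) := ⟨⟨0, hk⟩⟩
  obtain ⟨F, hFd, hF0, hF1⟩ := exists_hermite_interpolant hv Finset.univ (fun i => h (α i))
    fun i => deriv h (α i)
  have hFn : F.natDegree ≤ 2 * k - 1 := natDegree_le_of_degree_lt hFd (by omega)
  have hlp : lpBound n hn N F = (N : ℝ) ^ 2 * ∑ i, ρ i * h (α i) := by
    rw [lpBound_eq n hn hN (hq.formula F hFn)]
    simp only [hF0]
  refine ⟨F, ⟨hFn, hF0, fun i => hF1 i (Finset.mem_univ i)⟩, fun G hG => ?_, fun t ht => ?_,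
    fun f hf hfI => ?_, hlp⟩
  · refine sub_eq_zero.mp (eq_zero_of_hermite_data_eq_zero hv Finset.univ _
      ((degree_sub_le _ _).trans_lt (max_lt ?_ hFd)) (fun i => ?_) fun i hi => ?_)
    · exact degree_lt_of_natDegree_le hG.natDegree_le (by omega)
    · rw [eval_sub, hG.eval_eq, hF0, sub_self]
    · rw [derivative_sub, eval_sub, hG.deriv_eq, hF1 i hi, sub_self]
  · refine hh.hermite_le hv Finset.univ (fun i => ⟨(hq.neg_one_lt i).le, (hq.lt_one i).le⟩)
      (fun i _ => ⟨hq.neg_one_lt i, hq.lt_one i⟩) hFd hF0 hF1 (Set.Ico_subset_Icc_self (hI ht)) ?_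
    -- Every node is doubled, so the nodal polynomial is a square.
    exact mul_self_nonneg _
  · rw [hlp, lpBound_eq n hn hN (hq.formula f hf)]
    refine mul_le_mul_of_nonneg_left (Finset.sum_le_sum fun i _ => ?_) (sq_nonneg _)
    exact mul_le_mul_of_nonneg_left (hfI _ (hαI i)) (hq.weight_pos i).le

theorem IsEvenQuadrature.exists_optimal_hermite {n : ℕ} {hn : 2 ≤ n} {N k : ℕ} (hN : 0 < N)
    {β γ : Fin (k + 1) → ℝ} (hq : IsEvenQuadrature n hn N k β γ) {I : Set ℝ}
    {h : ℝ → ℝ} (hI : I ⊆ Set.Ico (-1) 1) (hh : AbsolutelyMonotoneOn h (Set.Icc (-1) 1))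
    (hβI : ∀ i, β i ∈ I) :
    ∃ F : ℝ[X], IsEvenHermite k β h F ∧ (∀ G : ℝ[X], IsEvenHermite k β h G → G = F) ∧
      IsBelowOn I h F ∧
      (∀ f : ℝ[X], f.natDegree ≤ 2 * k → IsBelowOn I h f →
        lpBound n hn N f ≤ lpBound n hn N F) ∧
      lpBound n hn N F = (N : ℝ) ^ 2 * ∑ i, γ i * h (β i) := by
  have hv := hq.strictMono.injective
  set D : Finset (Fin (k + 1)) := Finset.univ.erase 0
  have hmem : ∀ i, i ∈ D ↔ i ≠ 0 := fun i => by simp [D]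
  have hcard : Fintype.card (Fin (k + 1)) + D.card = 2 * k + 1 := by
    simp [D]; omega
  have hgt : ∀ i ∈ D, -1 < β i := fun i hi => by
    rw [← hq.zero_eq]
    exact hq.strictMono (Fin.pos_iff_ne_zero.mpr ((hmem i).mp hi))
  obtain ⟨F, hFd, hF0, hF1⟩ := exists_hermite_interpolant hv D (fun i => h (β i))
    fun i => deriv h (β i)
  have hFn : F.natDegree ≤ 2 * k := natDegree_le_of_degree_lt hFd (by omega)
  have hlp : lpBound n hn N F = (N : ℝ) ^ 2 * ∑ i, γ i * h (β i) := by
    rw [lpBound_eq n hn hN (hq.formula F hFn)]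
    simp only [hF0]
  refine ⟨F, ⟨hFn, hF0, fun i hi => hF1 i ((hmem i).mpr hi)⟩, fun G hG => ?_, fun t ht => ?_,
    fun f hf hfI => ?_, hlp⟩
  · refine sub_eq_zero.mp (eq_zero_of_hermite_data_eq_zero hv D _
      ((degree_sub_le _ _).trans_lt (max_lt ?_ hFd)) (fun i => ?_) fun i hi => ?_)
    · exact degree_lt_of_natDegree_le hG.natDegree_le (by omega)
    · rw [eval_sub, hG.eval_eq, hF0, sub_self]
    · rw [derivative_sub, eval_sub, hG.deriv_eq i ((hmem i).mp hi), hF1 i hi, sub_self]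
  · refine hh.hermite_le hv D (fun i => Set.Ico_subset_Icc_self (hI (hβI i)))
      (fun i hi => ⟨hgt i hi, hq.lt_one i⟩) hFd hF0 hF1 (Set.Ico_subset_Icc_self (hI ht)) ?_
    -- Only `-1` is a simple node: the nodal polynomial is `t + 1` times a square, nonnegative on
    -- `[-1, 1)`.
    rw [← Finset.mul_prod_erase Finset.univ (fun i => t - β i) (Finset.mem_univ 0), mul_assoc,
      hq.zero_eq]
    exact mul_nonneg (by linarith [(hI ht).1]) (mul_self_nonneg _)
  · rw [hlp, lpBound_eq n hn hN (hq.formula f hf)]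
    refine mul_le_mul_of_nonneg_left (Finset.sum_le_sum fun i _ => ?_) (sq_nonneg _)
    exact mul_le_mul_of_nonneg_left (hfI _ (hβI i)) (hq.weight_pos i).le

theorem theorem3p5 (n τ N : ℕ) (hn : 2 ≤ n) (hτ : 1 ≤ τ)
    (hN : dgsBound n τ < N) (hN' : N ≤ dgsBound n (τ + 1)) :
    (∀ k : ℕ, τ = 2 * k - 1 →
      ∃ α ρ : Fin k → ℝ, IsOddQuadrature n hn N k α ρ ∧
        (∀ α' ρ' : Fin k → ℝ, IsOddQuadrature n hn N k α' ρ' → α' = α ∧ ρ' = ρ) ∧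
        ∀ (I : Set ℝ) (h : ℝ → ℝ), I ⊆ Set.Ico (-1) 1 →
          AbsolutelyMonotoneOn h (Set.Icc (-1) 1) → (∀ i, α i ∈ I) →
          ∃ F : Polynomial ℝ, IsOddHermite k α h F ∧
            (∀ G : Polynomial ℝ, IsOddHermite k α h G → G = F) ∧
            IsBelowOn I h F ∧
            (∀ f : Polynomial ℝ, f.natDegree ≤ τ → IsBelowOn I h f →
              lpBound n hn N f ≤ lpBound n hn N F) ∧
            lpBound n hn N F = (N : ℝ) ^ 2 * ∑ i, ρ i * h (α i)) ∧
    (∀ k : ℕ, τ = 2 * k →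
      ∃ β γ : Fin (k + 1) → ℝ, IsEvenQuadrature n hn N k β γ ∧
        (∀ β' γ' : Fin (k + 1) → ℝ, IsEvenQuadrature n hn N k β' γ' → β' = β ∧ γ' = γ) ∧
        ∀ (I : Set ℝ) (h : ℝ → ℝ), I ⊆ Set.Ico (-1) 1 →
          AbsolutelyMonotoneOn h (Set.Icc (-1) 1) → (∀ i, β i ∈ I) →
          ∃ F : Polynomial ℝ, IsEvenHermite k β h F ∧
            (∀ G : Polynomial ℝ, IsEvenHermite k β h G → G = F) ∧
            IsBelowOn I h F ∧
            (∀ f : Polynomial ℝ, f.natDegree ≤ τ → IsBelowOn I h f →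
              lpBound n hn N f ≤ lpBound n hn N F) ∧
            lpBound n hn N F = (N : ℝ) ^ 2 * ∑ i, γ i * h (β i)) := by
  have hN0 : 0 < N := by omega
  refine ⟨fun k hk => ?_, fun k hk => ?_⟩
  · subst hk
    -- Since `2 * k - 1` truncates to `0` at `k = 0`, `hτ` gives `1 ≤ k`.
    obtain ⟨α, ρ, hq, huniq⟩ := exists_isOddQuadrature n hn N k (by omega) hN
    exact ⟨α, ρ, hq, huniq, fun I h hI hh hαI =>
      hq.exists_optimal_hermite hN0 (by omega) hI hh hαI⟩
  · subst hk
    obtain ⟨β, γ, hq, huniq⟩ := exists_isEvenQuadrature n hn N k (by omega) hN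
    exact ⟨β, γ, hq, huniq, fun I h hI hh hβI => hq.exists_optimal_hermite hN0 hI hh hβI⟩
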